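/- For non-negative integers $n,r,s,t$ with $r\ge 2$ let $$A_n^{(r,s,t)}=\sum_{k=0}^n\binom nk^r\binom{n+k}{k}^s\binom{2k}{n}^t$$ (with $\binom{a}{b}=0$ for integers $0\le a<b$, and $0^0=1$), and let the Bernoulli numbers $B_j$ be defined by $\frac{z}{e^z-1}=\sum_{j\ge 0}B_j\frac{z^j}{j!}$. For a prime $p$, an integer $e\ge 0$ and rational numbers $x,y$, write $x\equiv y\pmod{p^e}$ if $x-y=p^e c$ for some rational number $c$ whose denominator in lowest terms is not divisible by $p$. **Theorem.** Let $p\ge 5$ be a prime, let $n,m\ge 1$ be integers, and let $r,s,t\ge 0$ be integers with $r\ge 2$. Then $$A_{np^m}^{(r,s,t)}\equiv A_{np^{m-1}}^{(r,s,t)}+p^{3m}B_{p-3}\,\mathcal A_n^{(r,s,t)}\pmod{p^{3m+1}},$$ where the rational number $\mathcal A_n^{(r,s,t)}$, which does not depend on $m$ and $p$, is given by $$\begin{aligned}\mathcal A_n^{(2,s,t)}={}&-\frac13\sum_{k=0}^{n}\binom nk^2\binom{n+k}{k}^s\binom{2k}{n}^t nk\,(sn+sk+2n-2k+4tk-2tn)\\&+\frac16\sum_{k=0}^{n-1}\binom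 nk^2\binom{n+k}{k}^s\binom{2k}{n}^t(n-k)^2\,(9nt-3ns+24k-18n+14)\\&+\frac16\sum_{k=0}^{n-1}\binom nk^2\binom{n+k}{k}^s\binom{2k+1}{n}^t(n-k)^2\,(9ns+15nt-24k+6n-10),\end{aligned}$$ $$\begin{aligned}\mathcal A_n^{(3,s,t)}={}&-\frac13\sum_{k=0}^{n}\binom nk^3\binom{n+k}{k}^s\binom{2k}{n}^t nk\,(sn+sk+3n-3k+4tk-2tn)\\&+\frac14\sum_{k=0}^{n-1}(n-k)^3\binom nk^3\binom{n+k}{k}^s\left(\binom{2k}{n}^t+\binom{2k+1}{n}^t\right),\end{aligned}$$ and, for $r\ge 4$, $$\mathcal A_n^{(r,s,t)}=-\frac13\sum_{k=0}^{n}\binom nk^r\binom{n+k}{k}^s\binom{2k}{n}^t nk\,(sn+sk+rn-rk+4tk-2tn).$$ -/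

import Mathlib

/-- The numbers `A_n^{(r,s,t)} = ∑_{k=0}^n C(n,k)^r C(n+k,k)^s C(2k,n)^t`. -/
def aperyA (r s t n : ℕ) : ℕ :=
  ∑ k ∈ Finset.range (n + 1),
    n.choose k ^ r * (n + k).choose k ^ s * (2 * k).choose n ^ t

/-- The sum `-(1/3) ∑_{k=0}^n C(n,k)^r C(n+k,k)^s C(2k,n)^t nk(sn+sk+rn-rk+4tk-2tn)`. All
arithmetic outside the binomial coefficients takes place in `ℚ`. -/
def scriptAMain (r s t n : ℕ) : ℚ :=
  -(1 / 3) * ∑ k ∈ Finset.range (n + 1),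
    (n.choose k : ℚ) ^ r * ((n + k).choose k : ℚ) ^ s * ((2 * k).choose n : ℚ) ^ t *
      ((n : ℚ) * k * (s * n + s * k + r * n - r * k + 4 * t * k - 2 * t * n))

/-- The additional sums, over `0 ≤ k ≤ n - 1`, which appear for `r = 2`. -/
def scriptAExtraTwo (s t n : ℕ) : ℚ :=
  (1 / 6) * ∑ k ∈ Finset.range n,
      (n.choose k : ℚ) ^ 2 * ((n + k).choose k : ℚ) ^ s * ((2 * k).choose n : ℚ) ^ t *
        (((n : ℚ) - k) ^ 2 * (9 * n * t - 3 * n * s + 24 * k - 18 * n + 14)) +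
  (1 / 6) * ∑ k ∈ Finset.range n,
      (n.choose k : ℚ) ^ 2 * ((n + k).choose k : ℚ) ^ s * ((2 * k + 1).choose n : ℚ) ^ t *
        (((n : ℚ) - k) ^ 2 * (9 * n * s + 15 * n * t - 24 * k + 6 * n - 10))

/-- The additional sum, over `0 ≤ k ≤ n - 1`, which appears for `r = 3`. -/
def scriptAExtraThree (s t n : ℕ) : ℚ :=
  (1 / 4) * ∑ k ∈ Finset.range n,
    ((n : ℚ) - k) ^ 3 * (n.choose k : ℚ) ^ 3 * ((n + k).choose k : ℚ) ^ s *
      (((2 * k).choose n : ℚ) ^ t + ((2 * k + 1).choose n : ℚ) ^ t)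

/-- The rational number `𝒜_n^{(r,s,t)}`, with separate formulas for `r = 2`, `r = 3` and
`r ≥ 4` (the values for `r < 2` are never used). -/
def scriptA (r s t n : ℕ) : ℚ :=
  if r = 2 then scriptAMain 2 s t n + scriptAExtraTwo s t n
  else if r = 3 then scriptAMain 3 s t n + scriptAExtraThree s t n
  else scriptAMain r s t n

/-- Congruence `x ≡ y (mod p ^ e)` of rational numbers, `p` a prime: the difference `x - y` is
`p ^ e` times a rational number whose reduced denominator is not divisible by `p`. -/
def RatCongr (p e : ℕ) (x y : ℚ) : Prop :=
  ∃ c : ℚ, ¬ p ∣ c.den ∧ x - y = (p : ℚ) ^ e * c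

open Finset

/-! Put N = p^(a+1) n and split the sum for A_N according to whether p divides k, working in ℤ_[p]
modulo p^(3a+4). All power sums that occur reduce to one constant, `halfCubeSum p`, the sum of l⁻³
over 0 < l < p/2, which is -2 B_{p-3} mod p. Below, τ is a sixth of it, so -3τ ≡ B_{p-3}. The
recurring device: for odd L, a sum over 0, …, L can be folded by l ↔ L - l, or listed as evens 2l
and odds L - 2l. Comparing the two expressions yields linear relations between half-range sums.

Multiples of p. For k = pj and M = p^a n, ratios such as C(pM,pj)/C(M,j) are products of 1 ± pM/i
over i prime to p. Pairing i with its reflection shows that they are 1 + p³τ·(a cubic form in M, j)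
to sufficient precision (`prod_one_add_mul_iv_cong`), and r ≥ 2 supplies the powers of p missing
when p^a ∤ j (`aperyTerm_mul_cong`). The result is A_{p^a n} plus p³τ times the main sum at p^a n.
The latter is p^(3a) times the main sum at n, except that for r = 2 the j not divisible by p^a leave
a term proportional to p^a - 1.

Other k. Here C(N,k) = N/(N-k)·C(N-1,k) extracts N^r, so nothing survives for r ≥ 4. The cofactor is
needed mod p for r = 3 and mod p^(a+2) for r = 2. Because of C(2k,N), the remaining binomials are
governed by ⌊2k/L⌋, hence the half-blocks, `halfWeight`, and the pair C(2k,n), C(2k+1,n) in the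
answer. Mod p the weight is constant on half-blocks, which settles r = 3. For r = 2 it has a
first-order variation through harmonic sums, accumulated by descending from p^a n to n
(`sum_halfWeight_mul_descent`). This produces the opposite multiple of p^a - 1, and the dependence
on a cancels in `aperyA_two_cong`. -/

/-- Congruence modulo an element of a commutative ring. -/
def Cong {R : Type*} [CommRing R] (d x y : R) : Prop := d ∣ x - y

/-! ### Calculus of congruences -/

namespace Cong

variable {R : Type*} [CommRing R] {d e x y z x' y' : R}

theorem refl (d x : R) : Cong d x x := by simp [Cong]

theorem of_eq (h : x = y) : Cong d x y := h ▸ refl d x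

theorem symm (h : Cong d x y) : Cong d y x := by
  have := dvd_neg.mpr h
  rwa [neg_sub] at this

theorem trans (h : Cong d x y) (h' : Cong d y z) : Cong d x z := by
  have := dvd_add h h'
  rwa [sub_add_sub_cancel] at this

theorem add (h : Cong d x y) (h' : Cong d x' y') : Cong d (x + x') (y + y') := by
  have := dvd_add h h'
  rwa [← add_sub_add_comm] at this

theorem neg (h : Cong d x y) : Cong d (-x) (-y) := by
  have := dvd_neg.mpr h
  rwa [neg_sub, ← neg_sub_neg] at this

theorem sub (h : Cong d x y) (h' : Cong d x' y') : Cong d (x - x') (y - y') := by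
  simpa only [sub_eq_add_neg] using h.add h'.neg

theorem mul (h : Cong d x y) (h' : Cong d x' y') : Cong d (x * x') (y * y') := by
  have := dvd_add (h.mul_right x') (h'.mul_left y)
  have e : x * x' - y * y' = (x - y) * x' + y * (x' - y') := by ring
  rwa [Cong, e]

theorem const_mul (c : R) (h : Cong d x y) : Cong d (c * x) (c * y) := (refl d c).mul h

theorem mul_const (h : Cong d x y) (c : R) : Cong d (x * c) (y * c) := h.mul (refl d c)

theorem pow (h : Cong d x y) (k : ℕ) : Cong d (x ^ k) (y ^ k) := by
  induction k with
  | zero => simpa using refl d 1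
  | succ k ih => simpa only [pow_succ] using ih.mul h

theorem sum {ι : Type*} {s : Finset ι} {f g : ι → R} (h : ∀ i ∈ s, Cong d (f i) (g i)) :
    Cong d (∑ i ∈ s, f i) (∑ i ∈ s, g i) := by
  rw [Cong, ← sum_sub_distrib]
  exact dvd_sum h

theorem prod {ι : Type*} {s : Finset ι} {f g : ι → R} (h : ∀ i ∈ s, Cong d (f i) (g i)) :
    Cong d (∏ i ∈ s, f i) (∏ i ∈ s, g i) := by
  classical
  induction s using Finset.induction_on with
  | empty => simpa using refl d 1
  | insert a s ha ih =>
    rw [prod_insert ha, prod_insert ha]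
    exact (h a (mem_insert_self a s)).mul (ih fun i hi => h i (mem_insert_of_mem hi))

theorem of_dvd (h : Cong d x y) (hd : e ∣ d) : Cong e x y := hd.trans h

theorem scale (c : R) (h : Cong d x y) : Cong (c * d) (c * x) (c * y) := by
  rw [Cong, ← mul_sub]
  exact mul_dvd_mul_left c h

theorem zero_of_dvd (h : d ∣ x) : Cong d x 0 := by simpa [Cong] using h

theorem dvd (h : Cong d x 0) : d ∣ x := by simpa [Cong] using h

theorem dvd_of_dvd (h : Cong d x y) (hy : d ∣ y) : d ∣ x := (h.trans (zero_of_dvd hy)).dvd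

theorem cancel {c : R} (hc : IsUnit c) (h : Cong d (c * x) (c * y)) : Cong d x y := by
  rw [Cong, ← mul_sub] at h
  exact (hc.dvd_mul_left).mp h

/-- Every term of degree at least two in the expansion is divisible by `d`, so only the linear part
survives. -/
theorem prod_one_add {ι : Type*} {s : Finset ι} {f : ι → R} (h : ∀ i ∈ s, ∀ j ∈ s, d ∣ f i * f j) :
    Cong d (∏ i ∈ s, (1 + f i)) (1 + ∑ i ∈ s, f i) := by
  classical
  induction s using Finset.induction_on with
  | empty => simpa using refl d 1
  | insert a s ha ih =>
    rw [prod_insert ha, sum_insert ha]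
    have h1 := ih fun i hi j hj => h i (mem_insert_of_mem hi) j (mem_insert_of_mem hj)
    have h2 : d ∣ f a * ∑ i ∈ s, f i := by
      rw [mul_sum]
      exact dvd_sum fun i hi => h a (mem_insert_self a s) i (mem_insert_of_mem hi)
    refine (h1.const_mul (1 + f a)).trans ?_
    rw [Cong]
    convert h2 using 1
    ring

theorem one_add_pow (h : d ∣ x * x) (k : ℕ) : Cong d ((1 + x) ^ k) (1 + k * x) := by
  have := prod_one_add (d := d) (s := range k) (f := fun _ => x) fun _ _ _ _ => h
  simpa using this

end Cong

/-! ### Inverses in ℤ_[p] -/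

section Inverse

variable (p : ℕ) [hp : Fact p.Prime]

/-- The inverse of a natural number in `ℤ_[p]`, equal to `0` for multiples of `p`. -/
noncomputable def iv (k : ℕ) : ℤ_[p] := Ring.inverse (k : ℤ_[p])

variable {p}

theorem isUnit_natCast_iff {k : ℕ} : IsUnit (k : ℤ_[p]) ↔ ¬ p ∣ k := by
  rw [PadicInt.isUnit_iff, PadicInt.norm_natCast_eq_one_iff, Nat.coprime_comm, Nat.coprime_comm,
    hp.out.coprime_iff_not_dvd]

/-- This default lets sums and products run over full ranges: multiples of `p` drop out by
themselves. -/
theorem iv_of_dvd {k : ℕ} (h : p ∣ k) : iv p k = 0 :=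
  Ring.inverse_non_unit _ fun hu => isUnit_natCast_iff.mp hu h

theorem mul_iv {k : ℕ} (h : ¬ p ∣ k) : (k : ℤ_[p]) * iv p k = 1 :=
  Ring.mul_inverse_cancel _ (isUnit_natCast_iff.mpr h)

@[simp] theorem iv_zero : iv p 0 = 0 := iv_of_dvd (dvd_zero p)

theorem iv_mul (a b : ℕ) : iv p (a * b) = iv p a * iv p b := by
  rw [iv, Nat.cast_mul, Ring.mul_inverse_rev, mul_comm]; rfl

/-- This is 1/(y+x) = 1/x - y/(x(y+x)); when p ∣ x both sides are 0. -/
theorem iv_add {y : ℕ} (hy : p ∣ y) (x : ℕ) :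
    iv p (y + x) = iv p x - y * iv p x * iv p (y + x) := by
  by_cases hx : p ∣ x
  · rw [iv_of_dvd hx, iv_of_dvd (dvd_add hy hx)]; ring
  · have h1 := mul_iv hx
    have h2 := mul_iv (p := p) (k := y + x) (fun h => hx ((Nat.dvd_add_right hy).mp h))
    push_cast at h2
    linear_combination (-iv p (y + x)) * h1 + iv p x * h2

theorem iv_sub {y : ℕ} (hy : p ∣ y) {x : ℕ} (hxy : x ≤ y) :
    iv p (y - x) = -iv p x + y * iv p x * iv p (y - x) := by
  by_cases hx : p ∣ x
  · rw [iv_of_dvd hx, iv_of_dvd (Nat.dvd_sub hy hx)]; ring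
  · have h1 := mul_iv hx
    have h2 := mul_iv (p := p) (k := y - x) (fun h => hx ((Nat.dvd_sub_iff_right hxy hy).mp h))
    rw [Nat.cast_sub hxy] at h2
    linear_combination (-iv p (y - x)) * h1 - iv p x * h2

theorem iv_add_cong {y : ℕ} (hy : p ∣ y) (x : ℕ) : Cong (y : ℤ_[p]) (iv p (y + x)) (iv p x) := by
  refine ⟨-(iv p x * iv p (y + x)), ?_⟩
  linear_combination iv_add hy x

theorem iv_sub_cong {y : ℕ} (hy : p ∣ y) {x : ℕ} (hxy : x ≤ y) :
    Cong (y : ℤ_[p]) (iv p (y - x)) (-iv p x) := by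
  refine ⟨iv p x * iv p (y - x), ?_⟩
  linear_combination iv_sub hy hxy

theorem iv_sq_add_cong {y : ℕ} (hy : p ∣ y) (x : ℕ) :
    Cong ((y : ℤ_[p]) ^ 2) (iv p (y + x) ^ 2) (iv p x ^ 2 - 2 * y * iv p x ^ 3) := by
  obtain ⟨z, hz⟩ := iv_add_cong hy x
  have h := iv_add hy x
  refine ⟨-2 * iv p x ^ 2 * z + (iv p x * iv p (y + x)) ^ 2, ?_⟩
  linear_combination (iv p (y + x) + iv p x - y * iv p x * iv p (y + x)) * h - 2 * iv p x ^ 2 * y * hz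

theorem iv_sq_sub_cong {y : ℕ} (hy : p ∣ y) {x : ℕ} (hxy : x ≤ y) :
    Cong ((y : ℤ_[p]) ^ 2) (iv p (y - x) ^ 2) (iv p x ^ 2 + 2 * y * iv p x ^ 3) := by
  obtain ⟨z, hz⟩ := iv_sub_cong hy hxy
  have h := iv_sub hy hxy
  refine ⟨-2 * iv p x ^ 2 * z + (iv p x * iv p (y - x)) ^ 2, ?_⟩
  linear_combination (iv p (y - x) - iv p x + y * iv p x * iv p (y - x)) * h - 2 * iv p x ^ 2 * y * hz

theorem isUnit_of_lt {k : ℕ} (h0 : k ≠ 0) (h : k < p) : IsUnit (k : ℤ_[p]) :=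
  isUnit_natCast_iff.mpr (Nat.not_dvd_of_pos_of_lt (Nat.pos_of_ne_zero h0) h)

theorem isUnit_two (hp5 : 5 ≤ p) : IsUnit (2 : ℤ_[p]) := by
  exact_mod_cast isUnit_of_lt (p := p) (k := 2) (by norm_num) (by omega)

theorem isUnit_three (hp5 : 5 ≤ p) : IsUnit (3 : ℤ_[p]) := by
  exact_mod_cast isUnit_of_lt (p := p) (k := 3) (by norm_num) (by omega)

theorem two_mul_iv_two (hp5 : 5 ≤ p) : 2 * iv p 2 = 1 := by
  exact_mod_cast mul_iv (p := p) (k := 2) (Nat.not_dvd_of_pos_of_lt (by norm_num) (by omega))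

end Inverse

/-! ### Two ways of halving a sum -/

section Sums

theorem sum_range_reflect_pairs {R : Type*} [AddCommMonoid R] (f : ℕ → R) (g : ℕ) :
    ∑ l ∈ range (g + 1), (f l + f (2 * g + 1 - l)) = ∑ l ∈ range (2 * g + 2), f l := by
  rw [show 2 * g + 2 = (g + 1) + (g + 1) by ring, sum_range_add f, sum_add_distrib,
    ← sum_range_reflect (fun l => f (g + 1 + l))]
  congr 1
  refine sum_congr rfl fun l hl => ?_
  rw [mem_range] at hl
  congr 1
  omega

/-- With L = 2g + 1, the numbers 0, …, L are the evens 2l and the odds L - 2l. Played off against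
`sum_range_reflect_pairs`. -/
theorem sum_range_even_odd {R : Type*} [AddCommMonoid R] (f : ℕ → R) (g : ℕ) :
    ∑ l ∈ range (g + 1), (f (2 * l) + f (2 * g + 1 - 2 * l)) = ∑ l ∈ range (2 * g + 2), f l := by
  have h : ∀ k, ∑ l ∈ range (2 * k), f l = ∑ l ∈ range k, f (2 * l) + ∑ l ∈ range k, f (2 * l + 1) := by
    intro k
    induction k with
    | zero => simp
    | succ k ih =>
      rw [mul_add, mul_one, sum_range_succ, sum_range_succ, ih, sum_range_succ, sum_range_succ]
      abel
  rw [show 2 * g + 2 = 2 * (g + 1) by ring, h, sum_add_distrib,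
    ← sum_range_reflect (fun l => f (2 * l + 1))]
  congr 1
  refine sum_congr rfl fun l hl => ?_
  rw [mem_range] at hl
  congr 1
  omega

end Sums

theorem neg_one_pow_sub {R : Type*} [CommRing R] {n l : ℕ} (h : l ≤ n) :
    (-1 : R) ^ (n - l) = (-1) ^ n * (-1) ^ l := by
  obtain ⟨k, rfl⟩ := Nat.exists_eq_add_of_le h
  rw [Nat.add_sub_cancel_left, pow_add, mul_right_comm, ← mul_pow]
  simp

theorem exists_odd_quotient {p L g : ℕ} (hL : L = 2 * g + 1) (hpL : p ∣ L) :
    ∃ f, L = p * (2 * f + 1) := by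
  obtain ⟨y, rfl⟩ := hpL
  have : Odd (p * y) := ⟨g, hL⟩
  obtain ⟨f, hf⟩ := (Nat.odd_mul.mp this).2
  exact ⟨f, by rw [hf]⟩

/-! ### Sums of inverse squares and cubes -/

section PowerSums

variable {p : ℕ} [hp : Fact p.Prime]

variable (p) in
/-- The sum of `1 / l ^ 3` over `0 < l < p / 2`. -/
noncomputable def halfCubeSum : ℤ_[p] := ∑ l ∈ range ((p + 1) / 2), iv p l ^ 3

theorem sum_range_mul_blocks {R : Type*} [AddCommMonoid R] (f : ℕ → R) (b L : ℕ) :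
    ∑ k ∈ range (b * L), f k = ∑ j ∈ range b, ∑ l ∈ range L, f (j * L + l) := by
  induction b with
  | zero => simp
  | succ b ih => rw [add_mul, one_mul, sum_range_add, ih, sum_range_succ]

theorem natCast_dvd_of_dvd {a b : ℕ} (h : a ∣ b) : (a : ℤ_[p]) ∣ (b : ℤ_[p]) := by
  obtain ⟨c, rfl⟩ := h
  exact ⟨c, by push_cast; ring⟩

/-- The reflection l ↦ y - l changes the sign of an odd power mod p. -/
theorem sum_iv_pow_odd_cong (hp5 : 5 ≤ p) {y k : ℕ} (hy : p ∣ y) (hk : Odd k) :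
    Cong (p : ℤ_[p]) (∑ l ∈ range y, iv p l ^ k) 0 := by
  have h0 : ∑ l ∈ range y, iv p l ^ k = ∑ l ∈ range (y + 1), iv p l ^ k := by
    rw [sum_range_succ, iv_of_dvd hy, zero_pow hk.pos.ne', add_zero]
  have h1 : Cong (p : ℤ_[p]) (∑ l ∈ range (y + 1), iv p l ^ k)
      (-∑ l ∈ range (y + 1), iv p l ^ k) := by
    nth_rewrite 1 [← sum_range_reflect]
    rw [← sum_neg_distrib]
    refine Cong.sum fun l hl => ?_
    rw [mem_range] at hl
    have := ((iv_sub_cong hy (x := l) (by omega)).of_dvd (natCast_dvd_of_dvd hy)).pow k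
    rwa [hk.neg_pow, ← show y + 1 - 1 - l = y - l by omega] at this
  rw [h0]
  refine Cong.cancel (isUnit_two hp5) ?_
  have h2 := h1.add (Cong.refl _ (∑ l ∈ range (y + 1), iv p l ^ k))
  rw [← two_mul] at h2
  simpa using h2

/-- Folding gives F ≡ 2W + 2LT, the even-odd listing F ≡ W/2 + LT/4; solve for F and W in terms of
T. -/
theorem sum_iv_sq_cong (hp5 : 5 ≤ p) {L g : ℕ} (hL : L = 2 * g + 1) (hpL : p ∣ L) :
    Cong ((L : ℤ_[p]) ^ 2) (3 * ∑ l ∈ range L, iv p l ^ 2)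
      (-L * ∑ l ∈ range (g + 1), iv p l ^ 3) ∧
    Cong ((L : ℤ_[p]) ^ 2) (6 * ∑ l ∈ range (g + 1), iv p l ^ 2)
      (-7 * L * ∑ l ∈ range (g + 1), iv p l ^ 3) := by
  set F := ∑ l ∈ range L, iv p l ^ 2 with hF
  set W := ∑ l ∈ range (g + 1), iv p l ^ 2 with hW
  set T := ∑ l ∈ range (g + 1), iv p l ^ 3 with hT
  have h0 : ∑ l ∈ range (2 * g + 2), iv p l ^ 2 = F := by
    rw [show 2 * g + 2 = L + 1 by omega, sum_range_succ, iv_of_dvd hpL]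
    simp [hF]
  have hi := two_mul_iv_two hp5
  have h1 : Cong ((L : ℤ_[p]) ^ 2) F (2 * W + 2 * L * T) := by
    rw [← h0, ← sum_range_reflect_pairs, hW, hT, mul_sum, mul_sum, ← sum_add_distrib]
    refine Cong.sum fun l hl => ?_
    rw [mem_range] at hl
    have h := (Cong.refl ((L : ℤ_[p]) ^ 2) (iv p l ^ 2)).add
      (iv_sq_sub_cong hpL (x := l) (by omega))
    rw [← hL]
    exact h.trans (Cong.of_eq (by ring))
  have h2 : Cong ((L : ℤ_[p]) ^ 2) F (2 * (iv p 2 ^ 2 * W) + 2 * L * (iv p 2 ^ 3 * T)) := by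
    rw [← h0, ← sum_range_even_odd, hW, hT, mul_sum, mul_sum, mul_sum, mul_sum, ← sum_add_distrib]
    refine Cong.sum fun l hl => ?_
    rw [mem_range] at hl
    have h := (Cong.refl ((L : ℤ_[p]) ^ 2) (iv p (2 * l) ^ 2)).add
      (iv_sq_sub_cong hpL (x := 2 * l) (by omega))
    rw [← hL]
    exact h.trans (Cong.of_eq (by rw [iv_mul]; ring))
  have h3 : Cong ((L : ℤ_[p]) ^ 2) (3 * F) (-L * T) := by
    have := (h2.const_mul 4).sub h1
    refine (Cong.of_eq (by ring)).trans (this.trans (Cong.of_eq ?_))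
    linear_combination
      (2 * W * (2 * iv p 2 + 1) + L * T * (4 * iv p 2 ^ 2 + 2 * iv p 2 + 1)) * hi
  obtain ⟨a, ha⟩ := h1
  obtain ⟨b, hb⟩ := id h3
  exact ⟨h3, b - 3 * a, by linear_combination hb - 3 * ha⟩

/-- The half-range of L is `f` full periods mod p, contributing 0, followed by half a period. -/
theorem sum_half_iv_cube_cong (hp5 : 5 ≤ p) {L g f : ℕ} (hL : L = 2 * g + 1)
    (hpL : L = p * (2 * f + 1)) :
    Cong (p : ℤ_[p]) (∑ l ∈ range (g + 1), iv p l ^ 3) (halfCubeSum p) := by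
  obtain ⟨h, hh⟩ : ∃ h, p = 2 * h + 1 := by
    have : Odd p := hp.out.odd_of_ne_two (by omega)
    exact this
  have hg : g + 1 = p * f + (h + 1) := by
    have : 2 * g + 1 = 2 * (p * f) + p := by rw [← hL, hpL]; ring
    omega
  rw [hg, sum_range_add, halfCubeSum, show (p + 1) / 2 = h + 1 by omega]
  have h1 := sum_iv_pow_odd_cong hp5 (dvd_mul_right p f) (k := 3) (by decide)
  refine (h1.add (Cong.sum fun l _ => ?_)).trans (Cong.of_eq (zero_add _))
  exact ((iv_add_cong (dvd_mul_right p f) l).of_dvd (natCast_dvd_of_dvd (dvd_mul_right p f))).pow 3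

theorem p_mul_dvd_sq {L : ℕ} (hpL : p ∣ L) : (p : ℤ_[p]) * L ∣ (L : ℤ_[p]) ^ 2 := by
  rw [sq]
  exact mul_dvd_mul_right (natCast_dvd_of_dvd hpL) _

theorem three_mul_sum_iv_sq_cong (hp5 : 5 ≤ p) {L g : ℕ} (hL : L = 2 * g + 1) (hpL : p ∣ L) :
    Cong ((p : ℤ_[p]) * L) (3 * ∑ l ∈ range L, iv p l ^ 2) (-L * halfCubeSum p) := by
  obtain ⟨f, hf⟩ := exists_odd_quotient hL hpL
  refine ((sum_iv_sq_cong hp5 hL hpL).1.of_dvd (p_mul_dvd_sq hpL)).trans ?_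
  have := (sum_half_iv_cube_cong hp5 hL hf).scale (-L : ℤ_[p])
  exact this.of_dvd ⟨-1, by ring⟩

theorem six_mul_sum_half_iv_sq_cong (hp5 : 5 ≤ p) {L g : ℕ} (hL : L = 2 * g + 1) (hpL : p ∣ L) :
    Cong ((p : ℤ_[p]) * L) (6 * ∑ l ∈ range (g + 1), iv p l ^ 2) (-7 * L * halfCubeSum p) := by
  obtain ⟨f, hf⟩ := exists_odd_quotient hL hpL
  refine ((sum_iv_sq_cong hp5 hL hpL).2.of_dvd (p_mul_dvd_sq hpL)).trans ?_
  have := (sum_half_iv_cube_cong hp5 hL hf).scale (-7 * L : ℤ_[p])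
  exact this.of_dvd ⟨-7, by ring⟩

/-- Cut the range into blocks of odd length pq. Moving a block to the origin costs a multiple of
pq·∑ l⁻³, and p divides that last sum. -/
theorem three_mul_sum_range_mul_iv_sq_cong (hp5 : 5 ≤ p) {q b : ℕ} (hq : ∃ e, q = p ^ e)
    (hb : q ∣ b) :
    Cong ((p : ℤ_[p]) ^ 2 * q) (3 * ∑ i ∈ range (p * b), iv p i ^ 2)
      (-(p * b) * halfCubeSum p) := by
  obtain ⟨b', rfl⟩ := hb
  have hodd : Odd (p * q) := by
    obtain ⟨e, rfl⟩ := hq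
    have : Odd p := hp.out.odd_of_ne_two (by omega)
    exact this.mul this.pow
  obtain ⟨g, hg⟩ := hodd
  have hpL : p ∣ p * q := dvd_mul_right p q
  have key : Cong ((p : ℤ_[p]) * ((p * q : ℕ) : ℤ_[p])) (∑ i ∈ range (b' * (p * q)), iv p i ^ 2)
      (b' * ∑ l ∈ range (p * q), iv p l ^ 2) := by
    rw [sum_range_mul_blocks]
    have : ∀ j ∈ range b', Cong ((p : ℤ_[p]) * ((p * q : ℕ) : ℤ_[p]))
        (∑ l ∈ range (p * q), iv p (j * (p * q) + l) ^ 2) (∑ l ∈ range (p * q), iv p l ^ 2) := by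
      intro j _
      have hd : ((p : ℤ_[p]) * ((p * q : ℕ) : ℤ_[p])) ∣ ((j * (p * q) : ℕ) : ℤ_[p]) ^ 2 :=
        (p_mul_dvd_sq hpL).trans (pow_dvd_pow_of_dvd (natCast_dvd_of_dvd (dvd_mul_left _ _)) 2)
      have h1 := Cong.sum (s := range (p * q)) fun l _ =>
        (iv_sq_add_cong (p := p) (y := j * (p * q)) (hpL.mul_left j) l).of_dvd hd
      refine h1.trans ?_
      rw [sum_sub_distrib, ← mul_sum]
      have h3 := (sum_iv_pow_odd_cong hp5 hpL (k := 3) (by decide)).scale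
        (2 * ((j * (p * q) : ℕ) : ℤ_[p]))
      have h4 : Cong ((p : ℤ_[p]) * ((p * q : ℕ) : ℤ_[p])) (2 * ((j * (p * q) : ℕ) : ℤ_[p]) *
          ∑ l ∈ range (p * q), iv p l ^ 3) (2 * ((j * (p * q) : ℕ) : ℤ_[p]) * 0) :=
        h3.of_dvd ⟨2 * j, by push_cast; ring⟩
      exact ((Cong.refl _ _).sub h4).trans (Cong.of_eq (by ring))
    refine (Cong.sum this).trans (Cong.of_eq ?_)
    rw [sum_const, card_range, nsmul_eq_mul]
  have h2 := three_mul_sum_iv_sq_cong hp5 hg hpL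
  have h5 := (key.const_mul 3).trans
    ((Cong.of_eq (mul_left_comm _ _ _)).trans (h2.const_mul (b' : ℤ_[p])))
  rw [show p * (q * b') = b' * (p * q) by ring]
  refine (h5.of_dvd ⟨1, by push_cast; ring⟩).trans (Cong.of_eq (by push_cast; ring))

end PowerSums

/-! ### Half-blocks and their power sums -/

section Blocks

variable {p : ℕ} [hp : Fact p.Prime]

/-- The integers `k` with `⌊2 k / L⌋ = c`. -/
def halfBlock (L c : ℕ) : Finset ℕ := Ico ((c * L + 1) / 2) (((c + 1) * L + 1) / 2)

theorem mem_halfBlock {L c k : ℕ} : k ∈ halfBlock L c ↔ c * L ≤ 2 * k ∧ 2 * k < (c + 1) * L := by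
  rw [halfBlock, mem_Ico]
  generalize c * L = x
  generalize (c + 1) * L = y
  omega

theorem sum_consecutive_blocks {R : Type*} [AddCommMonoid R] (f : ℕ → R) {a : ℕ → ℕ}
    (ha : Monotone a) (n : ℕ) :
    ∑ c ∈ range n, ∑ k ∈ Ico (a c) (a (c + 1)), f k = ∑ k ∈ Ico (a 0) (a n), f k := by
  induction n with
  | zero => simp
  | succ n ih =>
    rw [sum_range_succ, ih, sum_Ico_consecutive _ (ha (Nat.zero_le n)) (ha (Nat.le_succ n))]

theorem sum_range_eq_sum_halfBlock {R : Type*} [AddCommMonoid R] (f : ℕ → R) (n L : ℕ) :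
    ∑ k ∈ range (n * L), f k = ∑ c ∈ range (2 * n), ∑ k ∈ halfBlock L c, f k := by
  have := sum_consecutive_blocks f (a := fun c => (c * L + 1) / 2)
    (fun c d h => Nat.div_le_div_right (Nat.succ_le_succ (Nat.mul_le_mul_right L h))) (2 * n)
  rw [range_eq_Ico, show n * L = (2 * n * L + 1) / 2 by rw [mul_assoc]; omega]
  simpa [halfBlock] using this.symm

theorem sum_halfBlock_mul {R : Type*} [AddCommMonoid R] (f : ℕ → R) (q L c : ℕ) :
    ∑ k ∈ halfBlock (q * L) c, f k = ∑ d ∈ range q, ∑ k ∈ halfBlock L (q * c + d), f k := by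
  have := sum_consecutive_blocks f (a := fun d => ((q * c + d) * L + 1) / 2)
    (fun x y h => Nat.div_le_div_right (Nat.succ_le_succ (Nat.mul_le_mul_right L (by omega)))) q
  simp only [halfBlock]
  rw [show c * (q * L) = (q * c + 0) * L by ring, show (c + 1) * (q * L) = (q * c + q) * L by ring,
    ← this]
  rfl

theorem sum_halfBlock_even {R : Type*} [AddCommMonoid R] (f : ℕ → R) {L g : ℕ} (hL : L = 2 * g + 1)
    (K : ℕ) : ∑ k ∈ halfBlock L (2 * K), f k = ∑ l ∈ range (g + 1), f (K * L + l) := by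
  rw [halfBlock, sum_Ico_eq_sum_range,
    show (2 * K * L + 1) / 2 = K * L by rw [mul_assoc]; omega,
    show (((2 * K + 1) * L + 1) / 2) = K * L + (g + 1) by rw [add_mul, mul_assoc]; omega,
    Nat.add_sub_cancel_left]

/-- The block is counted downwards from (K+1)L. That endpoint lies outside it; `h0` allows adding it
as l = 0, so even and odd blocks share one index range. -/
theorem sum_halfBlock_odd {R : Type*} [AddCommMonoid R] (f : ℕ → R) {L g : ℕ} (hL : L = 2 * g + 1)
    (K : ℕ) (h0 : f ((K + 1) * L) = 0) :
    ∑ k ∈ halfBlock L (2 * K + 1), f k = ∑ l ∈ range (g + 1), f ((K + 1) * L - l) := by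
  rw [halfBlock, sum_Ico_eq_sum_range, sum_range_succ', tsub_zero, h0, add_zero,
    show ((2 * K + 1) * L + 1) / 2 = K * L + (g + 1) by rw [add_mul, mul_assoc]; omega,
    show (((2 * K + 1 + 1) * L + 1) / 2) = K * L + L by
      rw [show (2 * K + 1 + 1) * L = 2 * (K * L + L) by ring]; omega,
    show K * L + L - (K * L + (g + 1)) = g by omega, ← sum_range_reflect]
  refine sum_congr rfl fun l hl => ?_
  rw [mem_range] at hl
  rw [add_mul]
  congr 1
  omega

/-- A half-block is a translate (c even) or a reflection (c odd) of the initial half-range; the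
first-order cost of moving it is the part linear in c. -/
theorem sum_halfBlock_iv_sq_cong (hp5 : 5 ≤ p) {L : ℕ} (hodd : Odd L) (hpL : p ∣ L) (c : ℕ) :
    Cong ((p : ℤ_[p]) * L) (6 * ∑ k ∈ halfBlock L c, iv p k ^ 2)
      (-L * halfCubeSum p * (4 + (-1) ^ c * (3 + 6 * c))) := by
  obtain ⟨g, hL⟩ := hodd
  obtain ⟨f, hf⟩ := exists_odd_quotient hL hpL
  have hW := six_mul_sum_half_iv_sq_cong hp5 hL hpL
  have hT := sum_half_iv_cube_cong hp5 hL hf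
  have hd (j : ℕ) : (p : ℤ_[p]) * L ∣ ((j * L : ℕ) : ℤ_[p]) ^ 2 :=
    (p_mul_dvd_sq hpL).trans (pow_dvd_pow_of_dvd (natCast_dvd_of_dvd (dvd_mul_left _ _)) 2)
  rcases Nat.even_or_odd' c with ⟨K, rfl | rfl⟩
  · have h1 := Cong.sum (s := range (g + 1)) fun l _ =>
      (iv_sq_add_cong (p := p) (y := K * L) (hpL.mul_left K) l).of_dvd (hd K)
    rw [sum_sub_distrib, ← mul_sum] at h1
    rw [sum_halfBlock_even _ hL]
    obtain ⟨a, ha⟩ := h1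
    obtain ⟨b, hb⟩ := hW
    obtain ⟨e, he⟩ := hT
    refine ⟨6 * a + b - 12 * K * e, ?_⟩
    rw [Even.neg_one_pow ⟨K, by ring⟩]
    push_cast at ha ⊢
    linear_combination 6 * ha + hb - 12 * K * L * he
  · have h1 := Cong.sum (s := range (g + 1)) fun l hl =>
      (iv_sq_sub_cong (p := p) (y := (K + 1) * L) (hpL.mul_left (K + 1)) (x := l)
        (by rw [mem_range] at hl; rw [add_mul]; omega)).of_dvd (hd (K + 1))
    rw [sum_add_distrib, ← mul_sum] at h1
    rw [sum_halfBlock_odd _ hL _ (by rw [iv_of_dvd (hpL.mul_left _)]; simp)]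
    obtain ⟨a, ha⟩ := h1
    obtain ⟨b, hb⟩ := hW
    obtain ⟨e, he⟩ := hT
    refine ⟨6 * a + b + 12 * (K + 1) * e, ?_⟩
    rw [Odd.neg_one_pow ⟨K, by ring⟩]
    push_cast at ha ⊢
    linear_combination 6 * ha + hb + 12 * (K + 1) * L * he

/-- Under l ↦ L - l both the sign and the cube flip, so folding doubles the alternating sum; the
even-odd listing turns it into plain cubes. -/
theorem sum_half_alternating_iv_cube_cong (hp5 : 5 ≤ p) {L g : ℕ} (hL : L = 2 * g + 1)
    (hpL : p ∣ L) :
    Cong (p : ℤ_[p]) (8 * ∑ l ∈ range (g + 1), (-1) ^ l * iv p l ^ 3) (halfCubeSum p) := by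
  obtain ⟨f, hf⟩ := exists_odd_quotient hL hpL
  have hT := sum_half_iv_cube_cong hp5 hL hf
  have hi := two_mul_iv_two hp5
  have hsub : ∀ l ≤ L, Cong (p : ℤ_[p]) (iv p (L - l) ^ 3) (-iv p l ^ 3) := fun l hl =>
    (((iv_sub_cong hpL hl).of_dvd (natCast_dvd_of_dvd hpL)).pow 3).trans (Cong.of_eq (by ring))
  have h1 : Cong (p : ℤ_[p]) (∑ l ∈ range (2 * g + 2), (-1) ^ l * iv p l ^ 3)
      (2 * ∑ l ∈ range (g + 1), (-1) ^ l * iv p l ^ 3) := by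
    rw [← sum_range_reflect_pairs, mul_sum]
    refine Cong.sum fun l hl => ?_
    rw [mem_range] at hl
    rw [← hL]
    have hs : (-1 : ℤ_[p]) ^ (L - l) = -(-1) ^ l := by
      rw [neg_one_pow_sub (by omega), Odd.neg_one_pow ⟨g, hL⟩, neg_one_mul]
    rw [hs]
    exact ((Cong.refl _ _).add ((hsub l (by omega)).const_mul _)).trans (Cong.of_eq (by ring))
  have h2 : Cong (p : ℤ_[p]) (∑ l ∈ range (2 * g + 2), (-1) ^ l * iv p l ^ 3)
      (2 * (iv p 2 ^ 3 * ∑ l ∈ range (g + 1), iv p l ^ 3)) := by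
    rw [← sum_range_even_odd, mul_sum, mul_sum]
    refine Cong.sum fun l hl => ?_
    rw [mem_range] at hl
    rw [← hL, Even.neg_one_pow ⟨l, by ring⟩, Odd.neg_one_pow ⟨g - l, by omega⟩]
    refine ((Cong.refl _ _).add ((hsub (2 * l) (by omega)).const_mul _)).trans (Cong.of_eq ?_)
    rw [iv_mul]
    ring
  obtain ⟨a, ha⟩ := h1
  obtain ⟨b, hb⟩ := h2
  obtain ⟨e, he⟩ := hT
  refine ⟨-4 * a + 4 * b + e, ?_⟩
  linear_combination -4 * ha + 4 * hb + he +
    (∑ l ∈ range (g + 1), iv p l ^ 3) * (4 * iv p 2 ^ 2 + 2 * iv p 2 + 1) * hi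

theorem sum_halfBlock_alternating_iv_cube_cong (hp5 : 5 ≤ p) {L : ℕ} (hodd : Odd L) (hpL : p ∣ L)
    (c : ℕ) :
    Cong (p : ℤ_[p]) (8 * ∑ k ∈ halfBlock L c, (-1) ^ k * iv p k ^ 3)
      ((-1) ^ (c / 2) * halfCubeSum p) := by
  obtain ⟨g, hL⟩ := id hodd
  have h0 := sum_half_alternating_iv_cube_cong hp5 hL hpL
  rcases Nat.even_or_odd' c with ⟨K, rfl | rfl⟩
  · rw [sum_halfBlock_even _ hL, Nat.mul_div_cancel_left K two_pos]
    refine Cong.trans ?_ (h0.const_mul _)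
    rw [mul_left_comm]
    refine Cong.const_mul _ ?_
    rw [mul_sum]
    refine Cong.sum fun l _ => ?_
    rw [← mul_assoc, pow_add, mul_comm K L, pow_mul, hodd.neg_one_pow]
    exact (((iv_add_cong (hpL.mul_right K) l).of_dvd
      (natCast_dvd_of_dvd (hpL.mul_right K))).pow 3).const_mul _
  · rw [sum_halfBlock_odd _ hL _ (by rw [iv_of_dvd (hpL.mul_left _)]; simp),
      show (2 * K + 1) / 2 = K by omega]
    refine Cong.trans ?_ (h0.const_mul _)
    rw [mul_left_comm]
    refine Cong.const_mul _ ?_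
    rw [mul_sum]
    refine Cong.sum fun l hl => ?_
    have hl' : l ≤ (K + 1) * L := by rw [mem_range] at hl; rw [add_mul]; omega
    have hs : (-1 : ℤ_[p]) ^ ((K + 1) * L - l) = -((-1) ^ K * (-1) ^ l) := by
      rw [neg_one_pow_sub hl', mul_comm (K + 1), pow_mul, hodd.neg_one_pow, pow_succ]
      ring
    rw [hs]
    refine ((((iv_sub_cong (hpL.mul_left (K + 1)) hl').of_dvd
      (natCast_dvd_of_dvd (hpL.mul_left (K + 1)))).pow 3).const_mul _).trans (Cong.of_eq ?_)
    ring

end Blocks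

/-! ### Binomial coefficients as products -/

section BinomialProducts

theorem cast_choose_succ_mul {R : Type*} [CommRing R] (n k : ℕ) :
    (n.choose (k + 1) : R) * (k + 1) = n.choose k * (n - k) := by
  rcases le_or_gt k n with h | h
  · have := congrArg (Nat.cast (R := R)) (Nat.choose_succ_right_eq n k)
    push_cast [Nat.cast_sub h] at this
    exact this
  · rw [Nat.choose_eq_zero_of_lt h, Nat.choose_eq_zero_of_lt (by omega)]
    simp

theorem pred_choose_mul {R : Type*} [CommRing R] {n k : ℕ} (hk : k < n) :
    (n.choose k : R) * (n - k) = n * (n - 1).choose k := by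
  obtain ⟨m, rfl⟩ : ∃ m, n = m + 1 := ⟨n - 1, by omega⟩
  have := congrArg (Nat.cast (R := R)) (Nat.choose_mul_succ_eq m k)
  rw [Nat.cast_mul, Nat.cast_mul, Nat.cast_sub (by omega)] at this
  rw [Nat.add_sub_cancel, ← this, mul_comm]

theorem cast_add_choose_succ_mul {R : Type*} [CommRing R] (n k : ℕ) :
    ((n + (k + 1)).choose (k + 1) : R) * (k + 1) = (n + k).choose k * (n + k + 1) := by
  have := congrArg (Nat.cast (R := R)) (Nat.add_one_mul_choose_eq (n + k) k)
  push_cast at this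
  rw [← add_assoc, ← this]
  ring

variable {p : ℕ} [hp : Fact p.Prime]

/-- In C(pY+k,k) = ∏ (1 + pY/i), 1 ≤ i ≤ k, the factors with p ∣ i assemble into the binomial
coefficient at level Y. `pred_choose_eq_prod` is the analogue with 1 - pY/i. -/
theorem add_choose_eq_prod (Y k : ℕ) :
    ((p * Y + k).choose k : ℤ_[p]) =
      (Y + k / p).choose (k / p) * ∏ i ∈ range (k + 1), (1 + p * Y * iv p i) := by
  induction k with
  | zero => simp
  | succ k ih =>
    have hk : ((k : ℤ_[p]) + 1) ≠ 0 := by exact_mod_cast Nat.succ_ne_zero k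
    apply mul_right_cancel₀ hk
    rw [cast_add_choose_succ_mul, ih, prod_range_succ _ (k + 1), Nat.succ_div]
    by_cases h : p ∣ k + 1
    · rw [if_pos h, iv_of_dvd h]
      have hz : ((k + 1 : ℕ) : ℤ_[p]) = p * ((k / p : ℕ) + 1) := by
        rw [← Nat.mul_div_cancel' h, Nat.succ_div, if_pos h]
        push_cast
        ring
      push_cast at hz ⊢
      rw [add_assoc _ (k : ℤ_[p]), hz]
      linear_combination (-p * ∏ i ∈ range (k + 1), (1 + (p : ℤ_[p]) * Y * iv p i)) *
        cast_add_choose_succ_mul (R := ℤ_[p]) Y (k / p)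
    · rw [if_neg h, add_zero]
      have := mul_iv h
      push_cast at this ⊢
      linear_combination (-(p : ℤ_[p]) * Y * ((Y + k / p).choose (k / p)) *
        ∏ i ∈ range (k + 1), (1 + (p : ℤ_[p]) * Y * iv p i)) * this

theorem pred_choose_eq_prod {Y k : ℕ} (hk : k < p * Y) :
    (-1) ^ k * ((p * Y - 1).choose k : ℤ_[p]) =
      (-1) ^ (k / p) * (Y - 1).choose (k / p) * ∏ i ∈ range (k + 1), (1 - p * Y * iv p i) := by
  induction k with
  | zero => simp
  | succ k ih =>
    have ih := ih (by omega)
    have hY : 1 ≤ Y := Nat.one_le_iff_ne_zero.mpr (by rintro rfl; simp at hk)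
    have hk0 : ((k : ℤ_[p]) + 1) ≠ 0 := by exact_mod_cast Nat.succ_ne_zero k
    have h1 := cast_choose_succ_mul (R := ℤ_[p]) (p * Y - 1) k
    apply mul_right_cancel₀ hk0
    rw [mul_assoc, h1, prod_range_succ _ (k + 1), Nat.succ_div, Nat.cast_sub (by omega)]
    have h2 : (-1) ^ (k + 1) * (((p * Y - 1).choose k : ℤ_[p]) * (((p * Y : ℕ) : ℤ_[p]) - (1 : ℕ) - k))
        = ((-1) ^ k * ((p * Y - 1).choose k : ℤ_[p])) * (k + 1 - p * Y) := by
      push_cast; ring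
    rw [h2, ih]
    by_cases h : p ∣ k + 1
    · rw [if_pos h, iv_of_dvd h]
      have hz : ((k + 1 : ℕ) : ℤ_[p]) = p * ((k / p : ℕ) + 1) := by
        rw [← Nat.mul_div_cancel' h, Nat.succ_div, if_pos h]
        push_cast
        ring
      have h3 := cast_choose_succ_mul (R := ℤ_[p]) (Y - 1) (k / p)
      rw [Nat.cast_sub hY] at h3
      push_cast at hz h3 ⊢
      rw [hz, pow_succ]
      linear_combination (p * (-1) ^ (k / p) *
        ∏ i ∈ range (k + 1), (1 - (p : ℤ_[p]) * Y * iv p i)) * h3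
    · rw [if_neg h, add_zero]
      have := mul_iv h
      push_cast at this ⊢
      linear_combination ((p : ℤ_[p]) * Y * (-1) ^ (k / p) * ((Y - 1).choose (k / p)) *
        ∏ i ∈ range (k + 1), (1 - (p : ℤ_[p]) * Y * iv p i)) * this

end BinomialProducts

/-! ### Harmonic sums mod p -/

section Harmonic

variable {p : ℕ} [hp : Fact p.Prime]

variable (p) in
/-- The sum of the inverses of the positive integers up to `x` that are prime to `p`. -/
noncomputable def harm (x : ℕ) : ℤ_[p] := ∑ i ∈ range (x + 1), iv p i

@[simp] theorem harm_zero : harm p 0 = 0 := by simp [harm]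

theorem harm_succ (x : ℕ) : harm p (x + 1) = harm p x + iv p (x + 1) := sum_range_succ _ _

theorem harm_add_cong (hp5 : 5 ≤ p) {y : ℕ} (hy : p ∣ y) (x : ℕ) :
    Cong (p : ℤ_[p]) (harm p (y + x)) (harm p x) := by
  rw [harm, add_assoc, sum_range_add]
  have h1 := sum_iv_pow_odd_cong hp5 hy (k := 1) (by decide)
  simp only [pow_one] at h1
  refine (h1.add (Cong.sum fun l _ => ?_)).trans (Cong.of_eq (zero_add _))
  exact (iv_add_cong hy l).of_dvd (natCast_dvd_of_dvd hy)

/-- The right side is H_{x-1}, written so as to make sense at x = 0. -/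
theorem harm_sub_cong (hp5 : 5 ≤ p) {y : ℕ} (hy : p ∣ y) {x : ℕ} (hx : x ≤ y) :
    Cong (p : ℤ_[p]) (harm p (y - x)) (harm p x - iv p x) := by
  induction x with
  | zero => simpa using harm_add_cong hp5 hy 0
  | succ x ih =>
    have h := ih (by omega)
    have h2 := harm_succ (p := p) (y - (x + 1))
    rw [show y - (x + 1) + 1 = y - x by omega] at h2
    have h3 := (iv_sub_cong hy (x := x) (by omega)).of_dvd (natCast_dvd_of_dvd (p := p) hy)
    rw [harm_succ]
    refine (Cong.of_eq (by linear_combination -h2)).trans ((h.sub h3).trans (Cong.of_eq (by ring)))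

theorem two_mul_sum_harm_mul_iv (n : ℕ) :
    2 * ∑ j ∈ range n, iv p (j + 1) * harm p (j + 1) =
      harm p n ^ 2 + ∑ l ∈ range (n + 1), iv p l ^ 2 := by
  induction n with
  | zero => simp
  | succ n ih =>
    rw [sum_range_succ, mul_add, ih, sum_range_succ _ (n + 1), harm_succ]
    ring

/-- Pascal's rule with C(n,i)/(i+1) = C(n+1,i+1)/(n+1). Raising n adds a sum with exponent one
lower, so the cases of exponent 1 and 2 follow by induction. -/
theorem sum_choose_succ_sub {n : ℕ} (hn : n + 1 < p) (e : ℕ) :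
    ∑ i ∈ range (p - 1), (-1) ^ i * ((n + 1).choose (i + 1) : ℤ_[p]) * iv p (i + 1) ^ (e + 1) =
      ∑ i ∈ range (p - 1), (-1) ^ i * (n.choose (i + 1) : ℤ_[p]) * iv p (i + 1) ^ (e + 1) +
      iv p (n + 1) *
        ∑ i ∈ range (p - 1), (-1) ^ i * ((n + 1).choose (i + 1) : ℤ_[p]) * iv p (i + 1) ^ e := by
  rw [mul_sum, ← sum_add_distrib]
  refine sum_congr rfl fun i hi => ?_
  rw [mem_range] at hi
  have h1 := mul_iv (p := p) (k := i + 1) (Nat.not_dvd_of_pos_of_lt (by omega) (by omega))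
  have h2 := mul_iv (p := p) (k := n + 1) (Nat.not_dvd_of_pos_of_lt (by omega) hn)
  have h3 := congrArg (Nat.cast (R := ℤ_[p])) (Nat.add_one_mul_choose_eq n i)
  have h4 : (n.choose i : ℤ_[p]) * iv p (i + 1) = iv p (n + 1) * (n + 1).choose (i + 1) := by
    push_cast at h1 h2 h3
    linear_combination (iv p (i + 1) * iv p (n + 1)) * h3 +
      iv p (n + 1) * (n + 1).choose (i + 1) * h1 - n.choose i * iv p (i + 1) * h2
  rw [Nat.choose_succ_succ'] at h4 ⊢
  push_cast at h4 ⊢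
  linear_combination (-1) ^ i * iv p (i + 1) ^ e * h4

theorem sum_alternating_choose_succ {n m : ℕ} (hn : n < m) :
    ∑ i ∈ range m, (-1) ^ i * ((n + 1).choose (i + 1) : ℤ_[p]) = 1 := by
  have h : ∀ i ∈ range m, (-1) ^ i * ((n + 1).choose (i + 1) : ℤ_[p]) =
      (-1) ^ i * (n.choose i : ℤ_[p]) - (-1) ^ (i + 1) * (n.choose (i + 1) : ℤ_[p]) := by
    intro i _
    rw [Nat.choose_succ_succ']
    push_cast
    ring
  rw [sum_congr rfl h, sum_range_sub', Nat.choose_eq_zero_of_lt hn]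
  simp

theorem sum_alternating_choose_mul_iv {n : ℕ} (hn : n < p) :
    ∑ i ∈ range (p - 1), (-1) ^ i * (n.choose (i + 1) : ℤ_[p]) * iv p (i + 1) ^ 1 = harm p n := by
  induction n with
  | zero => simp
  | succ n ih =>
    rw [sum_choose_succ_sub hn, ih (by omega), harm_succ]
    simp only [pow_zero, mul_one]
    rw [sum_alternating_choose_succ (by omega), mul_one]

theorem sum_alternating_choose_mul_iv_sq {n : ℕ} (hn : n < p) :
    ∑ i ∈ range (p - 1), (-1) ^ i * (n.choose (i + 1) : ℤ_[p]) * iv p (i + 1) ^ 2 =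
      ∑ j ∈ range n, iv p (j + 1) * harm p (j + 1) := by
  induction n with
  | zero => simp
  | succ n ih =>
    rw [sum_choose_succ_sub hn 1, ih (by omega), sum_alternating_choose_mul_iv hn, sum_range_succ]

/-- Take n = p - 1 in ∑ (-1)^(i-1) C(n,i)/i² = ∑ H_j/j. Mod p² the left side is -∑ i⁻² + p ∑ H_i/i²,
as (-1)^i C(p-1,i) ≡ 1 - pH_i; the right side is (H_{p-1}² + ∑ l⁻²)/2. Divide by p. -/
theorem two_mul_sum_harm_mul_iv_sq_cong (hp5 : 5 ≤ p) :
    Cong (p : ℤ_[p]) (2 * ∑ l ∈ range p, harm p l * iv p l ^ 2) (-halfCubeSum p) := by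
  obtain ⟨h, hh⟩ : Odd p := hp.out.odd_of_ne_two (by omega)
  have h1 : Cong ((p : ℤ_[p]) ^ 2)
      (∑ i ∈ range (p - 1), (-1) ^ i * ((p - 1).choose (i + 1) : ℤ_[p]) * iv p (i + 1) ^ 2)
      (∑ i ∈ range (p - 1), (-1 + p * harm p (i + 1)) * iv p (i + 1) ^ 2) := by
    refine Cong.sum fun i hi => Cong.mul_const ?_ _
    rw [mem_range] at hi
    have h2 := pred_choose_eq_prod (p := p) (Y := 1) (k := i + 1) (by omega)
    have h3 : Cong ((p : ℤ_[p]) ^ 2) (∏ j ∈ range (i + 1 + 1), (1 + -(p * iv p j)))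
        (1 + ∑ j ∈ range (i + 1 + 1), -(p * iv p j)) :=
      Cong.prod_one_add fun a _ b _ => ⟨iv p a * iv p b, by ring⟩
    rw [sum_neg_distrib, ← mul_sum] at h3
    rw [Nat.div_eq_of_lt (by omega)] at h2
    have h5 : (-1) ^ i * ((p - 1).choose (i + 1) : ℤ_[p]) =
        -∏ j ∈ range (i + 1 + 1), (1 + -(p * iv p j)) := by
      simp only [mul_one, Nat.choose_zero_right, pow_zero, one_mul, Nat.cast_one, pow_succ,
        sub_eq_add_neg] at h2 ⊢
      linear_combination -h2
    rw [h5]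
    exact h3.neg.trans (Cong.of_eq (by rw [harm]; ring))
  rw [sum_alternating_choose_mul_iv_sq (by omega)] at h1
  have h2 := two_mul_sum_harm_mul_iv (p := p) (p - 1)
  have hF : ∑ i ∈ range (p - 1), iv p (i + 1) ^ 2 = ∑ l ∈ range p, iv p l ^ 2 := by
    rw [show range p = range (p - 1 + 1) by congr 1; omega, sum_range_succ']
    simp
  have hD : ∑ i ∈ range (p - 1), harm p (i + 1) * iv p (i + 1) ^ 2 =
      ∑ l ∈ range p, harm p l * iv p l ^ 2 := by
    rw [show range p = range (p - 1 + 1) by congr 1; omega, sum_range_succ']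
    simp
  have h3 : ∑ i ∈ range (p - 1), (-1 + p * harm p (i + 1)) * iv p (i + 1) ^ 2 =
      -(∑ l ∈ range p, iv p l ^ 2) + p * ∑ l ∈ range p, harm p l * iv p l ^ 2 := by
    rw [← hF, ← hD, mul_sum, ← sum_neg_distrib, ← sum_add_distrib]
    exact sum_congr rfl fun i _ => by ring
  rw [h3] at h1
  rw [show p - 1 + 1 = p by omega] at h2
  obtain ⟨z, hz⟩ : (p : ℤ_[p]) ∣ harm p (p - 1) := by
    have := harm_sub_cong hp5 (dvd_refl p) (x := 1) (by omega)
    refine this.dvd_of_dvd ?_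
    rw [harm_succ]
    simp
  obtain ⟨a, ha⟩ := h1
  obtain ⟨b, hb⟩ := three_mul_sum_iv_sq_cong hp5 hh (dvd_refl p)
  refine ⟨b + z ^ 2 - 2 * a, ?_⟩
  have hp0 : (p : ℤ_[p]) ≠ 0 := by exact_mod_cast hp.out.ne_zero
  apply mul_left_cancel₀ hp0
  rw [hz] at h2
  linear_combination hb - 2 * ha + h2

theorem sum_half_harm_mul_iv_sq_cong (hp5 : 5 ≤ p) {h : ℕ} (hh : p = 2 * h + 1) :
    Cong (p : ℤ_[p]) (4 * ∑ l ∈ range (h + 1), harm p l * iv p l ^ 2) (halfCubeSum p) ∧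
    Cong (p : ℤ_[p]) (4 * ∑ l ∈ range (h + 1), harm p (2 * l) * iv p l ^ 2)
      (-3 * halfCubeSum p) := by
  have hi := two_mul_iv_two hp5
  have hT : ∑ l ∈ range (h + 1), iv p l ^ 3 = halfCubeSum p := by
    rw [halfCubeSum, show (p + 1) / 2 = h + 1 by omega]
  have hD := two_mul_sum_harm_mul_iv_sq_cong hp5
  have h0 : ∑ l ∈ range (2 * h + 2), harm p l * iv p l ^ 2 =
      ∑ l ∈ range p, harm p l * iv p l ^ 2 := by
    rw [show 2 * h + 2 = p + 1 by omega, sum_range_succ, iv_of_dvd (dvd_refl p)]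
    simp
  have hsub : ∀ l ≤ p, Cong (p : ℤ_[p]) (harm p (p - l) * iv p (p - l) ^ 2)
      (harm p l * iv p l ^ 2 - iv p l ^ 3) := fun l hl =>
    ((harm_sub_cong hp5 (dvd_refl p) hl).mul ((iv_sub_cong (dvd_refl p) hl).pow 2)).trans
      (Cong.of_eq (by ring))
  have h1 : Cong (p : ℤ_[p]) (∑ l ∈ range p, harm p l * iv p l ^ 2)
      (2 * ∑ l ∈ range (h + 1), harm p l * iv p l ^ 2 - halfCubeSum p) := by
    rw [← h0, ← sum_range_reflect_pairs, ← hT, mul_sum, ← sum_sub_distrib, ← hh]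
    refine Cong.sum fun l hl => ?_
    rw [mem_range] at hl
    exact ((Cong.refl _ _).add (hsub l (by omega))).trans (Cong.of_eq (by ring))
  have h2 : Cong (p : ℤ_[p]) (∑ l ∈ range p, harm p l * iv p l ^ 2)
      (2 * iv p 2 ^ 2 * ∑ l ∈ range (h + 1), harm p (2 * l) * iv p l ^ 2 -
        iv p 2 ^ 3 * halfCubeSum p) := by
    rw [← h0, ← sum_range_even_odd, ← hT, mul_sum, mul_sum, ← sum_sub_distrib, ← hh]
    refine Cong.sum fun l hl => ?_
    rw [mem_range] at hl
    exact ((Cong.refl _ _).add (hsub (2 * l) (by omega))).trans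
      (Cong.of_eq (by rw [iv_mul]; ring))
  obtain ⟨a, ha⟩ := hD
  obtain ⟨b, hb⟩ := h1
  obtain ⟨c, hc⟩ := h2
  constructor
  · exact ⟨a - 2 * b, by linear_combination ha - 2 * hb⟩
  · refine ⟨4 * a - 8 * c, ?_⟩
    linear_combination 4 * ha - 8 * hc + (-(2 * iv p 2 + 1) *
      4 * (∑ l ∈ range (h + 1), harm p (2 * l) * iv p l ^ 2) + halfCubeSum p *
      (4 * iv p 2 ^ 2 + 2 * iv p 2 + 1)) * hi

/-- This is the first-order coefficient when (N-k)⁻² times a weight is expanded over one half-block.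
-/
theorem sum_halfBlock_harm_cong (hp5 : 5 ≤ p) (a b : ℤ_[p]) (c : ℕ) :
    Cong (p : ℤ_[p])
      (4 * ∑ k ∈ halfBlock p c,
        (2 * iv p k ^ 3 + iv p k ^ 2 * (a * harm p k + b * harm p (2 * k))))
      (halfCubeSum p * (-(a + 4 * b) + (-1) ^ c * (8 + 2 * a + b))) := by
  obtain ⟨h, hh⟩ : Odd p := hp.out.odd_of_ne_two (by omega)
  have hi := two_mul_iv_two hp5
  have hT : ∑ l ∈ range (h + 1), iv p l ^ 3 = halfCubeSum p := by
    rw [halfCubeSum, show (p + 1) / 2 = h + 1 by omega]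
  obtain ⟨⟨x, hx⟩, ⟨y, hy⟩⟩ := sum_half_harm_mul_iv_sq_cong hp5 hh
  rcases Nat.even_or_odd' c with ⟨K, rfl | rfl⟩
  · rw [sum_halfBlock_even _ hh]
    have hd : p ∣ K * p := dvd_mul_left _ _
    have h1 : Cong (p : ℤ_[p])
        (∑ l ∈ range (h + 1), (2 * iv p (K * p + l) ^ 3 + iv p (K * p + l) ^ 2 *
          (a * harm p (K * p + l) + b * harm p (2 * (K * p + l)))))
        (2 * halfCubeSum p + a * (∑ l ∈ range (h + 1), harm p l * iv p l ^ 2) +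
          b * (∑ l ∈ range (h + 1), harm p (2 * l) * iv p l ^ 2)) := by
      rw [← hT, mul_sum, mul_sum, mul_sum, ← sum_add_distrib, ← sum_add_distrib]
      refine Cong.sum fun l _ => ?_
      have e1 := (iv_add_cong hd l).of_dvd (natCast_dvd_of_dvd (p := p) hd)
      have e2 := harm_add_cong hp5 hd l
      have e3 := harm_add_cong hp5 (hd.mul_left 2) (2 * l)
      rw [← mul_add] at e3
      exact (((e1.pow 3).const_mul 2).add ((e1.pow 2).mul
        ((e2.const_mul a).add (e3.const_mul b)))).trans (Cong.of_eq (by ring))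
    obtain ⟨z, hz⟩ := h1
    refine ⟨4 * z + a * x + b * y, ?_⟩
    rw [Even.neg_one_pow ⟨K, by ring⟩]
    linear_combination 4 * hz + a * hx + b * hy
  · rw [sum_halfBlock_odd _ hh _ (by rw [iv_of_dvd (dvd_mul_left _ _)]; simp)]
    have hd : p ∣ (K + 1) * p := dvd_mul_left _ _
    have h1 : Cong (p : ℤ_[p])
        (∑ l ∈ range (h + 1), (2 * iv p ((K + 1) * p - l) ^ 3 + iv p ((K + 1) * p - l) ^ 2 *
          (a * harm p ((K + 1) * p - l) + b * harm p (2 * ((K + 1) * p - l)))))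
        ((-2 - a - b * iv p 2) * halfCubeSum p +
          a * (∑ l ∈ range (h + 1), harm p l * iv p l ^ 2) +
          b * (∑ l ∈ range (h + 1), harm p (2 * l) * iv p l ^ 2)) := by
      rw [← hT, mul_sum, mul_sum, mul_sum, ← sum_add_distrib, ← sum_add_distrib]
      refine Cong.sum fun l hl => ?_
      have hl' : l ≤ (K + 1) * p := by rw [mem_range] at hl; rw [add_mul]; omega
      have e1 := (iv_sub_cong hd hl').of_dvd (natCast_dvd_of_dvd (p := p) hd)
      have e2 := harm_sub_cong hp5 hd hl'
      have e3 := harm_sub_cong hp5 (hd.mul_left 2) (x := 2 * l) (by omega)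
      rw [← Nat.mul_sub] at e3
      refine (((e1.pow 3).const_mul 2).add ((e1.pow 2).mul
        ((e2.const_mul a).add (e3.const_mul b)))).trans (Cong.of_eq ?_)
      rw [iv_mul]
      ring
    obtain ⟨z, hz⟩ := h1
    refine ⟨4 * z + a * x + b * y, ?_⟩
    rw [Odd.neg_one_pow ⟨K, by ring⟩]
    linear_combination 4 * hz + a * hx + b * hy - 2 * b * halfCubeSum p * hi

/-- Abel summation: the weight is the increment w(x+1) - w(x) of w(x) = x(4 - 3(-1)^x), and w
vanishes mod p at both ends of the block. -/
theorem sum_harm_mul_weight_cong (hp5 : 5 ≤ p) (a b : ℤ_[p]) (c : ℕ) :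
    Cong (p : ℤ_[p])
      (∑ d ∈ range p, (a * harm p ((p * c + d) / 2) + b * harm p (p * c + d)) *
        (4 + (-1) ^ (p * c + d) * (3 + 6 * (p * c + d : ℕ))))
      (a + 4 * b) := by
  set h : ℕ → ℤ_[p] := fun x => a * harm p (x / 2) + b * harm p x with hh
  set w : ℕ → ℤ_[p] := fun x => x * (4 - 3 * (-1) ^ x) with hw
  have h1 : ∀ d ∈ range p, h (p * c + d) * (4 + (-1) ^ (p * c + d) * (3 + 6 * (p * c + d : ℕ))) =
      (h (p * c + (d + 1)) * w (p * c + (d + 1)) - h (p * c + d) * w (p * c + d)) -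
        w (p * c + (d + 1)) * (h (p * c + (d + 1)) - h (p * c + d)) := by
    intro d _
    simp only [hw]
    push_cast
    ring
  rw [sum_congr rfl h1, sum_sub_distrib,
    sum_range_sub (fun d => h (p * c + d) * w (p * c + d))]
  have hw0 : ∀ z, Cong (p : ℤ_[p]) (w (p * z)) 0 := fun z =>
    Cong.zero_of_dvd ⟨z * (4 - 3 * (-1) ^ (p * z)), by simp only [hw]; push_cast; ring⟩
  -- At x = pc + d + 1 the increment of h is b/x, plus 2a/x if x is even. The factor x of w cancels,
  -- leaving 2a + b or 7b by parity.
  have h2 : ∀ d < p - 1, w (p * c + (d + 1)) * (h (p * c + (d + 1)) - h (p * c + d)) =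
      (a + 4 * b) + ((-1) ^ (p * c + 1) * (a - 3 * b)) * (-1) ^ d := by
    intro d hd
    have hiv := mul_iv (p := p) (k := p * c + (d + 1)) (by
      rw [Nat.dvd_add_right (dvd_mul_right p c)]
      exact Nat.not_dvd_of_pos_of_lt (by omega) (by omega))
    have hs : (-1 : ℤ_[p]) ^ (p * c + 1) * (-1) ^ d = (-1) ^ (p * c + (d + 1)) := by
      rw [← pow_add]; congr 1; ring
    have e1 : (-1 : ℤ_[p]) ^ (p * c + 1) * (a - 3 * b) * (-1) ^ d =
      (-1) ^ (p * c + (d + 1)) * (a - 3 * b) := by rw [← hs]; ring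
    rw [e1]
    simp only [hh, hw]
    rw [← add_assoc (p * c)] at hiv ⊢
    rw [harm_succ]
    rcases Nat.even_or_odd' (p * c + d + 1) with ⟨K, hK | hK⟩
    · obtain ⟨J, rfl⟩ : ∃ J, K = J + 1 := ⟨K - 1, by omega⟩
      rw [hK] at hiv ⊢
      rw [show p * c + d = 2 * J + 1 by omega, Nat.mul_div_cancel_left _ two_pos,
        show (2 * J + 1) / 2 = J by omega, harm_succ, Even.neg_one_pow ⟨J + 1, by ring⟩]
      have hi := two_mul_iv_two hp5
      rw [iv_mul] at hiv ⊢
      push_cast at hiv ⊢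
      linear_combination (b + 2 * a) * hiv - 2 * (J + 1) * iv p (J + 1) * a * hi
    · rw [hK] at hiv ⊢
      rw [show p * c + d = 2 * K by omega, Nat.mul_div_cancel_left _ two_pos,
        show (2 * K + 1) / 2 = K by omega, Odd.neg_one_pow ⟨K, by ring⟩]
      linear_combination 7 * b * hiv
  have h3 : Cong (p : ℤ_[p])
      (∑ d ∈ range p, w (p * c + (d + 1)) * (h (p * c + (d + 1)) - h (p * c + d)))
      (-(a + 4 * b)) := by
    obtain ⟨g, hg⟩ : Odd p := hp.out.odd_of_ne_two (by omega)
    rw [show range p = range (p - 1 + 1) by congr 1; omega, sum_range_succ,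
      sum_congr rfl fun d hd => h2 d (mem_range.mp hd), sum_add_distrib, ← mul_sum, sum_const,
      card_range, show p - 1 + 1 = p by omega, show p * c + p = p * (c + 1) by ring]
    have h4 : ∑ d ∈ range (p - 1), (-1 : ℤ_[p]) ^ d = 0 := by
      rw [neg_one_geom_sum, if_pos ⟨g, by omega⟩]
    rw [h4, nsmul_eq_mul, Nat.cast_sub (by omega), mul_zero, add_zero]
    obtain ⟨z, hz⟩ := (hw0 (c + 1)).mul_const (h (p * (c + 1)) - h (p * c + (p - 1)))
    exact ⟨(a + 4 * b) + z, by push_cast; linear_combination hz⟩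
  obtain ⟨x, hx⟩ := hw0 c
  obtain ⟨y, hy⟩ := hw0 (c + 1)
  obtain ⟨z, hz⟩ := h3
  refine ⟨h (p * (c + 1)) * y - h (p * c) * x - z, ?_⟩
  rw [show p * c + p = p * (c + 1) by ring, add_zero]
  linear_combination h (p * (c + 1)) * hy - h (p * c) * hx - hz

end Harmonic

/-! ### The Bernoulli number B_{p-3} -/

section BernoulliNumbers

variable {p : ℕ} [hp : Fact p.Prime]

/-- Up to this index the Bernoulli recurrence divides only by integers below p. -/
theorem exists_padicInt_eq_bernoulli {n : ℕ} (hn : n + 1 < p) :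
    ∃ b : ℤ_[p], (b : ℚ_[p]) = ((bernoulli n : ℚ) : ℚ_[p]) := by
  induction n using Nat.strong_induction_on with
  | _ n ih =>
    choose! b hb using ih
    obtain ⟨u, hu⟩ := isUnit_of_lt (p := p) (k := n + 1) (by omega) hn
    refine ⟨(u⁻¹ : ℤ_[p]ˣ) * ((if n = 0 then 1 else 0) -
      ∑ k ∈ range n, ((n + 1).choose k : ℤ_[p]) * b k), ?_⟩
    have h := congrArg (Rat.cast (K := ℚ_[p])) (sum_bernoulli (n + 1))
    simp only [sum_range_succ _ n, Nat.choose_succ_self_right, Nat.add_eq_right] at h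
    push_cast at h
    have h1 : (((∑ k ∈ range n, ((n + 1).choose k : ℤ_[p]) * b k : ℤ_[p])) : ℚ_[p]) =
        ∑ k ∈ range n, ((n + 1).choose k : ℚ_[p]) * ((bernoulli k : ℚ) : ℚ_[p]) := by
      rw [PadicInt.coe_sum]
      refine sum_congr rfl fun k hk => ?_
      rw [mem_range] at hk
      rw [PadicInt.coe_mul, PadicInt.coe_natCast, hb k hk (by omega)]
    have h2 : (((u⁻¹ : ℤ_[p]ˣ) : ℤ_[p]) : ℚ_[p]) * ((n : ℚ_[p]) + 1) = 1 := by
      have h3 : (((u⁻¹ : ℤ_[p]ˣ) : ℤ_[p])) * ((n + 1 : ℕ) : ℤ_[p]) = 1 := by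
        rw [← hu, Units.inv_mul]
      have := congrArg (fun z : ℤ_[p] => (z : ℚ_[p])) h3
      push_cast at this
      exact_mod_cast this
    have h4 : (((if n = 0 then 1 else 0 : ℤ_[p])) : ℚ_[p]) =
        (((if n = 0 then 1 else 0 : ℚ)) : ℚ_[p]) := by
      split_ifs <;> simp
    rw [PadicInt.coe_mul, PadicInt.coe_sub, h1, h4, ← h]
    linear_combination ((bernoulli n : ℚ) : ℚ_[p]) * h2

theorem add_pow_cong {R : Type*} [CommRing R] (x y : R) (k : ℕ) :
    Cong (y ^ 2) ((y + x) ^ (k + 1)) (x ^ (k + 1) + (k + 1) * y * x ^ k) := by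
  induction k with
  | zero => exact Cong.of_eq (by push_cast; ring)
  | succ k ih =>
    obtain ⟨z, hz⟩ := ih
    refine ⟨(y + x) * z + (k + 1) * x ^ k, ?_⟩
    rw [pow_succ (y + x)]
    push_cast
    linear_combination (y + x) * hz

theorem sum_range_pow_cong_bernoulli (hp5 : 5 ≤ p) {β : ℤ_[p]}
    (hβ : (β : ℚ_[p]) = ((bernoulli (p - 3) : ℚ) : ℚ_[p])) :
    Cong ((p : ℤ_[p]) ^ 2) (∑ l ∈ range p, (l : ℤ_[p]) ^ (p - 3)) (p * β) := by
  obtain ⟨k, rfl⟩ : ∃ k, p = k + 3 := ⟨p - 3, by omega⟩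
  rw [Nat.add_sub_cancel] at hβ ⊢
  choose! b hb using fun (i : ℕ) (hi : i < k) =>
    exists_padicInt_eq_bernoulli (p := k + 3) (n := i) (by omega)
  have h1 : ((k + 1 : ℕ) : ℤ_[k + 3]) * ∑ l ∈ range (k + 3), (l : ℤ_[k + 3]) ^ k =
      (∑ i ∈ range k, b i * ((k + 1).choose i) * ((k + 3 : ℕ) : ℤ_[k + 3]) ^ (k + 1 - i)) +
        β * (k + 1 : ℕ) * (k + 3 : ℕ) := by
    have h := congrArg (Rat.cast (K := ℚ_[k + 3])) (sum_range_pow (k + 3) k)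
    rw [← sum_div, sum_range_succ _ k, Nat.choose_succ_self_right, Nat.add_sub_cancel_left] at h
    have hk : ((k : ℚ_[k + 3]) + 1) ≠ 0 := by exact_mod_cast Nat.succ_ne_zero k
    push_cast at h
    rw [eq_div_iff hk] at h
    have h2 : ∑ i ∈ range k, (b i : ℚ_[k + 3]) * ((k + 1).choose i) *
        ((k : ℚ_[k + 3]) + 3) ^ (k + 1 - i) =
        ∑ i ∈ range k, ((bernoulli i : ℚ) : ℚ_[k + 3]) * ((k + 1).choose i) *
        ((k : ℚ_[k + 3]) + 3) ^ (k + 1 - i) :=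
      sum_congr rfl fun i hi => by rw [hb i (mem_range.mp hi)]
    apply PadicInt.ext
    simp only [PadicInt.coe_mul, PadicInt.coe_add, PadicInt.coe_sum, PadicInt.coe_pow,
      PadicInt.coe_natCast]
    push_cast
    rw [h2, hβ]
    linear_combination h
  have hu : IsUnit ((k + 1 : ℕ) : ℤ_[k + 3]) := isUnit_of_lt (by omega) (by omega)
  refine Cong.cancel hu ?_
  rw [h1]
  have h3 : Cong (((k + 3 : ℕ) : ℤ_[k + 3]) ^ 2)
      (∑ i ∈ range k, b i * ((k + 1).choose i) * ((k + 3 : ℕ) : ℤ_[k + 3]) ^ (k + 1 - i)) 0 := by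
    refine Cong.zero_of_dvd (dvd_sum fun i hi => Dvd.dvd.mul_left (pow_dvd_pow _ ?_) _)
    rw [mem_range] at hi
    omega
  exact (h3.add (Cong.refl _ _)).trans (Cong.of_eq (by ring))

theorem pow_sub_one_cong_one {l : ℕ} (hl : ¬ p ∣ l) :
    Cong (p : ℤ_[p]) ((l : ℤ_[p]) ^ (p - 1)) 1 := by
  have h := (Nat.ModEq.pow_totient ((Nat.coprime_comm.mp
    ((hp.out.coprime_iff_not_dvd).mpr hl)) : Nat.Coprime l p))
  rw [Nat.totient_prime hp.out] at h
  have h2 : ((p : ℤ)) ∣ ((l : ℤ) ^ (p - 1) - 1) := by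
    have := (Nat.modEq_iff_dvd.mp h.symm)
    exact_mod_cast this
  obtain ⟨z, hz⟩ := h2
  refine ⟨z, ?_⟩
  exact_mod_cast congrArg (Int.cast (R := ℤ_[p])) hz

theorem pow_sub_four_cong (hp5 : 5 ≤ p) (l : ℕ) :
    Cong (p : ℤ_[p]) ((l : ℤ_[p]) ^ (p - 4)) (iv p l ^ 3) := by
  by_cases hl : p ∣ l
  · rw [iv_of_dvd hl]
    refine (((Cong.zero_of_dvd (natCast_dvd_of_dvd (p := p) hl)).pow (p - 4))).trans
      (Cong.of_eq ?_)
    rw [zero_pow (by omega), zero_pow (by omega)]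
  · have h := (pow_sub_one_cong_one hl).mul_const (iv p l ^ 3)
    refine (Cong.of_eq ?_).trans (h.trans (Cong.of_eq (one_mul _)))
    rw [show p - 1 = (p - 4) + 3 by omega, pow_add, mul_assoc, ← mul_pow, mul_iv hl, one_pow,
      mul_one]

/-- Compare the two halvings of ∑ l^(p-3) ≡ p B_{p-3} mod p². Their first-order terms contain
l^(p-4) ≡ l⁻³, and 2^(p-4) ≡ 1/8. -/
theorem halfCubeSum_cong_bernoulli (hp5 : 5 ≤ p) {β : ℤ_[p]}
    (hβ : (β : ℚ_[p]) = ((bernoulli (p - 3) : ℚ) : ℚ_[p])) :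
    Cong (p : ℤ_[p]) (halfCubeSum p) (-2 * β) := by
  have hS := sum_range_pow_cong_bernoulli hp5 hβ
  obtain ⟨h, hh⟩ : Odd p := hp.out.odd_of_ne_two (by omega)
  obtain ⟨k, hk⟩ : ∃ k, p - 3 = k + 1 := ⟨p - 4, by omega⟩
  have hodd : Odd k := ⟨h - 2, by omega⟩
  rw [hk] at hS
  set S := ∑ l ∈ range p, (l : ℤ_[p]) ^ (k + 1) with hSdef
  have h0 : Cong ((p : ℤ_[p]) ^ 2) (∑ l ∈ range (2 * h + 2), (l : ℤ_[p]) ^ (k + 1)) S := by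
    rw [show 2 * h + 2 = p + 1 by omega, sum_range_succ]
    refine ((Cong.refl _ _).add (Cong.zero_of_dvd (pow_dvd_pow _ (by omega)))).trans
      (Cong.of_eq (add_zero _))
  have hsub : ∀ l ≤ p, Cong ((p : ℤ_[p]) ^ 2) (((p - l : ℕ) : ℤ_[p]) ^ (k + 1))
      ((l : ℤ_[p]) ^ (k + 1) - (k + 1) * p * (l : ℤ_[p]) ^ k) := by
    intro l hl
    rw [Nat.cast_sub hl, sub_eq_add_neg]
    refine (add_pow_cong (-(l : ℤ_[p])) p k).trans (Cong.of_eq ?_)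
    rw [hodd.neg_pow, (hodd.add_one).neg_pow]
    ring
  have h1 : Cong ((p : ℤ_[p]) ^ 2) (∑ l ∈ range (2 * h + 2), (l : ℤ_[p]) ^ (k + 1))
      (2 * (∑ l ∈ range (h + 1), (l : ℤ_[p]) ^ (k + 1)) -
        (k + 1) * p * ∑ l ∈ range (h + 1), (l : ℤ_[p]) ^ k) := by
    rw [← sum_range_reflect_pairs, mul_sum, mul_sum, ← sum_sub_distrib, ← hh]
    refine Cong.sum fun l hl => ?_
    rw [mem_range] at hl
    exact ((Cong.refl _ _).add (hsub l (by omega))).trans (Cong.of_eq (by ring))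
  have h2 : Cong ((p : ℤ_[p]) ^ 2) (∑ l ∈ range (2 * h + 2), (l : ℤ_[p]) ^ (k + 1))
      (4 * 2 ^ k * (∑ l ∈ range (h + 1), (l : ℤ_[p]) ^ (k + 1)) -
        (k + 1) * p * (2 ^ k * ∑ l ∈ range (h + 1), (l : ℤ_[p]) ^ k)) := by
    rw [← sum_range_even_odd, mul_sum, mul_sum, mul_sum, ← sum_sub_distrib, ← hh]
    refine Cong.sum fun l hl => ?_
    rw [mem_range] at hl
    refine ((Cong.refl _ _).add (hsub (2 * l) (by omega))).trans (Cong.of_eq ?_)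
    push_cast
    rw [mul_pow, mul_pow]
    ring
  have hT : Cong (p : ℤ_[p]) (∑ l ∈ range (h + 1), (l : ℤ_[p]) ^ k) (halfCubeSum p) := by
    rw [halfCubeSum, show (p + 1) / 2 = h + 1 by omega, show k = p - 4 by omega]
    exact Cong.sum fun l _ => pow_sub_four_cong hp5 l
  have htwo : Cong (p : ℤ_[p]) (8 * 2 ^ k) 1 := by
    have := pow_sub_one_cong_one (p := p) (l := 2) (Nat.not_dvd_of_pos_of_lt two_pos (by omega))
    rw [show p - 1 = k + 3 by omega, pow_add] at this
    refine (Cong.of_eq ?_).trans this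
    push_cast
    ring
  have hkp : (k : ℤ_[p]) + 4 = p := by
    have : k + 4 = p := by omega
    exact_mod_cast congrArg (Nat.cast (R := ℤ_[p])) this
  set X := ∑ l ∈ range (h + 1), (l : ℤ_[p]) ^ (k + 1)
  set Y := ∑ l ∈ range (h + 1), (l : ℤ_[p]) ^ k
  set S' := ∑ l ∈ range (2 * h + 2), (l : ℤ_[p]) ^ (k + 1)
  obtain ⟨s, hs⟩ := hS
  obtain ⟨s', hs'⟩ := h0
  obtain ⟨a, ha⟩ := h1
  obtain ⟨b, hb⟩ := h2
  obtain ⟨t, ht⟩ := hT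
  obtain ⟨z, hz⟩ := htwo
  -- Needed because 8·2^k ≡ 1 is known only mod p, while X enters a relation mod p².
  have hX : ∃ x, X = p * x := by
    have : Cong (p : ℤ_[p]) (2 * X) (2 * 0) :=
      ⟨(k + 1) * Y - p * a + p * s' + p * s + β, by linear_combination -ha + hs' + hs⟩
    obtain ⟨x, hx⟩ := this.cancel (isUnit_two hp5)
    exact ⟨x, by linear_combination hx⟩
  obtain ⟨x, hx⟩ := hX
  have hp0 : (p : ℤ_[p]) ≠ 0 := by exact_mod_cast hp.out.ne_zero
  refine Cong.cancel (isUnit_three hp5) ?_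
  have key : (p : ℤ_[p]) * (3 * halfCubeSum p - 3 * (-2 * β)) = p * (p * (Y - 3 * t - (k + 1) * z * Y
      + 4 * z * x + 8 * b - 2 * a - 6 * s' - 6 * s)) := by
    linear_combination (-3 * p) * ht - 6 * hs' - 6 * hs + 8 * hb - 2 * ha +
      (4 * X - (k + 1) * p * Y) * hz + 4 * p * z * hx + p * Y * hkp
  exact ⟨_, mul_left_cancel₀ hp0 key⟩

end BernoulliNumbers

/-! ### Products of 1 + pX/i -/

section BlockProducts

variable {p : ℕ} [hp : Fact p.Prime]

theorem isUnit_of_cong {x u : ℤ_[p]} (hu : IsUnit u) (h : Cong (p : ℤ_[p]) x u) : IsUnit x := by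
  by_contra hx
  rw [PadicInt.not_isUnit_iff, PadicInt.norm_lt_one_iff_dvd] at hx
  have hpu : (p : ℤ_[p]) ∣ u := h.symm.dvd_of_dvd hx
  rw [← PadicInt.norm_lt_one_iff_dvd, ← PadicInt.not_isUnit_iff] at hpu
  exact hpu hu

theorem isUnit_six (hp5 : 5 ≤ p) : IsUnit (6 : ℤ_[p]) := by
  have := (isUnit_two hp5).mul (isUnit_three hp5)
  norm_num at this
  exact this

theorem iv_mul_iv_sub_cong {y : ℕ} (hy : p ∣ y) {x : ℕ} (hxy : x ≤ y) :
    Cong ((y : ℤ_[p]) ^ 2) (iv p x * iv p (y - x)) (-iv p x ^ 2 - y * iv p x ^ 3) := by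
  have h := iv_sub hy hxy
  refine ⟨iv p x ^ 3 * iv p (y - x), ?_⟩
  linear_combination (iv p x + y * iv p x ^ 2) * h

/-- Multiply the factors at i and pb - i, using 1/i + 1/(pb-i) = pb/(i(pb-i)). -/
theorem prod_one_add_mul_iv_sq {b : ℕ} (X : ℤ_[p]) :
    (∏ i ∈ range (p * b), (1 + p * X * iv p i)) ^ 2 =
      ∏ i ∈ range (p * b + 1), (1 + p ^ 2 * X * (X + b) * (iv p i * iv p (p * b - i))) := by
  have h0 : ∏ i ∈ range (p * b), (1 + p * X * iv p i) =
      ∏ i ∈ range (p * b + 1), (1 + p * X * iv p i) := by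
    rw [prod_range_succ, iv_of_dvd (dvd_mul_right p b), mul_zero, add_zero, mul_one]
  rw [sq, h0]
  nth_rewrite 2 [← prod_range_reflect]
  rw [← prod_mul_distrib]
  refine prod_congr rfl fun i hi => ?_
  rw [mem_range] at hi
  have h := iv_sub (dvd_mul_right p b) (x := i) (by omega)
  rw [show p * b + 1 - 1 - i = p * b - i by omega]
  push_cast at h
  linear_combination (p : ℤ_[p]) * X * h

theorem sum_iv_mul_iv_sub_cong (hp5 : 5 ≤ p) {τ : ℤ_[p]} (hτ : 6 * τ = halfCubeSum p) {q b : ℕ}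
    (hq : ∃ e, q = p ^ e) (hb : q ∣ b) :
    Cong ((p : ℤ_[p]) ^ 2 * q) (∑ i ∈ range (p * b + 1), iv p i * iv p (p * b - i))
      (2 * p * b * τ) := by
  have hpb : p ∣ p * b := dvd_mul_right p b
  have hd : (p : ℤ_[p]) ^ 2 * q ∣ ((p * b : ℕ) : ℤ_[p]) ^ 2 := by
    obtain ⟨b', rfl⟩ := hb
    exact ⟨q * b' ^ 2, by push_cast; ring⟩
  have h1 := Cong.sum (s := range (p * b + 1)) fun i hi =>
    (iv_mul_iv_sub_cong hpb (x := i) (by rw [mem_range] at hi; omega)).of_dvd hd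
  refine h1.trans (Cong.cancel (isUnit_three hp5) ?_)
  rw [sum_sub_distrib, sum_neg_distrib, ← mul_sum, sum_range_succ _ (p * b),
    sum_range_succ _ (p * b), iv_of_dvd hpb]
  obtain ⟨x, hx⟩ := three_mul_sum_range_mul_iv_sq_cong hp5 hq hb
  obtain ⟨y, hy⟩ := sum_iv_pow_odd_cong hp5 hpb (k := 3) (by decide)
  obtain ⟨b', rfl⟩ := hb
  refine ⟨-x - 3 * b' * y, ?_⟩
  push_cast at hx hy ⊢
  linear_combination -hx - 3 * p * q * b' * hy - p * q * b' * hτ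

/-- The squared product is linear to this precision: Q ∣ X and q ∣ X + b multiply the error p²q of
`sum_iv_mul_iv_sub_cong`, along with p². -/
theorem prod_one_add_mul_iv_cong (hp5 : 5 ≤ p) {τ : ℤ_[p]} (hτ : 6 * τ = halfCubeSum p)
    {q Q b : ℕ} (hq : ∃ e, q = p ^ e) (hb : q ∣ b) (hqQ : q ∣ Q) {X : ℤ_[p]}
    (hX : (Q : ℤ_[p]) ∣ X) :
    Cong ((p : ℤ_[p]) ^ 4 * Q * q ^ 2) (∏ i ∈ range (p * b), (1 + p * X * iv p i))
      (1 + p ^ 3 * τ * (X * b * (X + b))) := by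
  obtain ⟨σ, hσ⟩ := sum_iv_mul_iv_sub_cong hp5 hτ hq hb
  obtain ⟨X', rfl⟩ := hX
  obtain ⟨Q', rfl⟩ := hqQ
  obtain ⟨b', rfl⟩ := hb
  set D : ℤ_[p] := (p : ℤ_[p]) ^ 4 * ((q * Q' : ℕ) : ℤ_[p]) * q ^ 2 with hD
  set Φ := ∏ i ∈ range (p * (q * b')), (1 + p * (((q * Q' : ℕ) : ℤ_[p]) * X') * iv p i) with hΦ
  have h1 : Cong D (Φ ^ 2) (1 + ∑ i ∈ range (p * (q * b') + 1),
      p ^ 2 * (((q * Q' : ℕ) : ℤ_[p]) * X') * (((q * Q' : ℕ) : ℤ_[p]) * X' + (q * b' : ℕ)) *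
        (iv p i * iv p (p * (q * b') - i))) := by
    rw [hΦ, prod_one_add_mul_iv_sq]
    refine Cong.prod_one_add fun i _ j _ => ⟨Q' * X' ^ 2 * (Q' * X' + b') ^ 2 * q *
      (iv p i * iv p (p * (q * b') - i)) * (iv p j * iv p (p * (q * b') - j)), ?_⟩
    rw [hD]
    push_cast
    ring
  rw [← mul_sum] at h1
  have h2 : Cong (p : ℤ_[p]) Φ 1 := by
    have h3 : Cong (p : ℤ_[p]) Φ (∏ i ∈ range (p * (q * b')), 1) :=
      Cong.prod fun i _ => ⟨((q * Q' : ℕ) : ℤ_[p]) * X' * iv p i, by ring⟩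
    rwa [prod_const_one] at h3
  -- To take the square root, factor Φ² - (1+E)², where E is the claimed correction; Φ + 1 + E ≡ 2
  -- is a unit.
  have hu : IsUnit (Φ + 1 + p ^ 3 * τ * (((q * Q' : ℕ) : ℤ_[p]) * X' * (q * b' : ℕ) *
      (((q * Q' : ℕ) : ℤ_[p]) * X' + (q * b' : ℕ)))) := by
    refine isUnit_of_cong (isUnit_two hp5) ?_
    obtain ⟨z, hz⟩ := h2
    refine ⟨z + p ^ 2 * τ * (((q * Q' : ℕ) : ℤ_[p]) * X' * (q * b' : ℕ) *
      (((q * Q' : ℕ) : ℤ_[p]) * X' + (q * b' : ℕ))), ?_⟩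
    linear_combination hz
  refine Cong.cancel hu ?_
  obtain ⟨w, hw⟩ := h1
  refine ⟨w + X' * (Q' * X' + b') * σ -
    p ^ 2 * τ ^ 2 * Q' * X' ^ 2 * b' ^ 2 * (Q' * X' + b') ^ 2 * q ^ 3, ?_⟩
  rw [hD] at hw ⊢
  push_cast at hw hσ ⊢
  linear_combination hw + p ^ 2 * q ^ 2 * Q' * X' * (Q' * X' + b') * hσ

end BlockProducts

/-! ### Variation of the weights on blocks -/

section Weights

variable {p : ℕ} [hp : Fact p.Prime]

variable (p) in
/-- The product of the (signed) binomial coefficients attached to a half-block. -/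
noncomputable def halfWeight (r s t Y c : ℕ) : ℤ_[p] :=
  ((-1) ^ (c / 2) * ((Y - 1).choose (c / 2) : ℤ_[p])) ^ r *
    ((Y + c / 2).choose (c / 2) : ℤ_[p]) ^ s * (c.choose Y : ℤ_[p]) ^ t

theorem add_choose_cong (Y k : ℕ) :
    Cong ((p * Y : ℤ_[p]) ^ 2) ((p * Y + k).choose k : ℤ_[p])
      ((Y + k / p).choose (k / p) * (1 + p * Y * harm p k)) := by
  rw [add_choose_eq_prod, harm, mul_sum]
  exact (Cong.prod_one_add fun i _ j _ => ⟨iv p i * iv p j, by ring⟩).const_mul _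

theorem pred_choose_cong {Y k : ℕ} (hk : k < p * Y) :
    Cong ((p * Y : ℤ_[p]) ^ 2) ((-1) ^ k * ((p * Y - 1).choose k : ℤ_[p]))
      ((-1) ^ (k / p) * (Y - 1).choose (k / p) * (1 + -(p * Y * harm p k))) := by
  rw [pred_choose_eq_prod hk, harm, mul_sum, ← sum_neg_distrib]
  simp only [sub_eq_add_neg]
  exact (Cong.prod_one_add fun i _ j _ => ⟨iv p i * iv p j, by ring⟩).const_mul _

theorem mul_add_choose_mul_cong (hp5 : 5 ≤ p) {Y c d : ℕ} (hd : d < p) :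
    Cong (p * (p * Y) : ℤ_[p]) ((p * c + d).choose (p * Y) : ℤ_[p])
      (c.choose Y * (1 + p * Y * harm p (p * c + d))) := by
  rcases lt_or_ge c Y with h | h
  · have h1 : p * c + d < p * Y := by
      calc p * c + d < p * c + p := by omega
        _ = p * (c + 1) := by ring
        _ ≤ p * Y := Nat.mul_le_mul_left p h
    rw [Nat.choose_eq_zero_of_lt h, Nat.choose_eq_zero_of_lt h1]
    exact Cong.of_eq (by simp)
  · obtain ⟨z, rfl⟩ := Nat.exists_eq_add_of_le h
    have h1 := add_choose_cong (p := p) Y (p * z + d)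
    rw [show (p * z + d) / p = z by
        rw [Nat.mul_add_div hp.out.pos, Nat.div_eq_of_lt hd, add_zero],
      ← Nat.choose_symm_add, ← Nat.choose_symm_add] at h1
    rw [show p * (Y + z) + d = p * Y + (p * z + d) by ring]
    obtain ⟨x, hx⟩ := h1
    obtain ⟨y, hy⟩ := harm_add_cong hp5 (dvd_mul_right p Y) (p * z + d)
    refine ⟨Y * x - (Y + z).choose Y * y, ?_⟩
    linear_combination hx - (Y + z).choose Y * p * Y * hy

/-- The three binomials contribute -rH, sH and tG, with H and G the harmonic sums at half the
argument and at the argument. The precision p·pY comes from periodicity of G mod p. -/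
theorem halfWeight_mul_cong (hp5 : 5 ≤ p) (r s t : ℕ) {Y c d : ℕ} (hc : c < 2 * Y) (hd : d < p) :
    Cong (p * (p * Y) : ℤ_[p]) (halfWeight p r s t (p * Y) (p * c + d))
      (halfWeight p r s t Y c * (1 + p * Y *
        ((s - r) * harm p ((p * c + d) / 2) + t * harm p (p * c + d)))) := by
  have hx : p * c + d < 2 * (p * Y) := by
    calc p * c + d < p * c + p := by omega
      _ = p * (c + 1) := by ring
      _ ≤ p * (2 * Y) := Nat.mul_le_mul_left p hc
      _ = 2 * (p * Y) := by ring
  have hdiv : (p * c + d) / 2 / p = c / 2 := by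
    rw [Nat.div_div_eq_div_mul, mul_comm 2 p, ← Nat.div_div_eq_div_mul, Nat.mul_add_div hp.out.pos,
      Nat.div_eq_of_lt hd, add_zero]
  have hD : (p * (p * Y) : ℤ_[p]) ∣ (p * Y : ℤ_[p]) ^ 2 := ⟨Y, by ring⟩
  have hsq : ∀ z : ℤ_[p], (p * (p * Y) : ℤ_[p]) ∣ (p * Y * z) * (p * Y * z) := fun z =>
    ⟨Y * z ^ 2, by ring⟩
  have h1 := (pred_choose_cong (p := p) (Y := Y) (k := (p * c + d) / 2) (by omega)).of_dvd hD
  have h2 := (add_choose_cong (p := p) Y ((p * c + d) / 2)).of_dvd hD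
  have h3 := mul_add_choose_mul_cong hp5 (Y := Y) (c := c) hd
  rw [hdiv] at h1 h2
  set H := harm p ((p * c + d) / 2)
  set G := harm p (p * c + d)
  refine (((h1.pow r).mul (h2.pow s)).mul (h3.pow t)).trans ?_
  rw [mul_pow _ (1 + _) r, mul_pow _ (1 + _) s, mul_pow _ (1 + _) t]
  have e1 := Cong.one_add_pow (x := -(p * Y * H)) (d := (p * (p * Y) : ℤ_[p]))
    (by rw [neg_mul_neg]; exact hsq H) r
  have e2 := Cong.one_add_pow (hsq H) s
  have e3 := Cong.one_add_pow (hsq G) t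
  have e4 := ((e1.mul e2).mul e3).const_mul (halfWeight p r s t Y c)
  refine (Cong.of_eq (by rw [halfWeight]; ring)).trans (e4.trans (Cong.const_mul _ ?_))
  refine ⟨Y * (s * t * H * G - r * s * H ^ 2 - r * t * H * G - r * s * t * p * Y * H ^ 2 * G), ?_⟩
  ring

theorem halfWeight_mul_cong_mod (hp5 : 5 ≤ p) (r s t : ℕ) {Y c d : ℕ} (hc : c < 2 * Y)
    (hd : d < p) :
    Cong (p : ℤ_[p]) (halfWeight p r s t (p * Y) (p * c + d)) (halfWeight p r s t Y c) := by
  refine ((halfWeight_mul_cong hp5 r s t hc hd).of_dvd (dvd_mul_right _ _)).trans ?_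
  exact ⟨halfWeight p r s t Y c * (Y *
    ((s - r) * harm p ((p * c + d) / 2) + t * harm p (p * c + d))), by ring⟩

theorem halfWeight_pow_mul_cong_mod (hp5 : 5 ≤ p) (r s t : ℕ) (a : ℕ) {Y x : ℕ}
    (hx : x < 2 * (p ^ a * Y)) :
    Cong (p : ℤ_[p]) (halfWeight p r s t (p ^ a * Y) x) (halfWeight p r s t Y (x / p ^ a)) := by
  induction a generalizing x with
  | zero => simpa using Cong.refl _ _
  | succ a ih =>
    have hlt : x / p < 2 * (p ^ a * Y) := by
      rw [Nat.div_lt_iff_lt_mul hp.out.pos]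
      calc x < 2 * (p ^ (a + 1) * Y) := hx
        _ = _ := by ring
    have h1 := halfWeight_mul_cong_mod hp5 r s t hlt (Nat.mod_lt x hp.out.pos)
    rw [Nat.div_add_mod, show p * (p ^ a * Y) = p ^ (a + 1) * Y by ring] at h1
    refine h1.trans ((ih hlt).trans (Cong.of_eq ?_))
    rw [Nat.div_div_eq_div_mul, pow_succ']

end Weights

/-! ### Descent for the indices prime to p -/

section Descent

variable {p : ℕ} [hp : Fact p.Prime]

theorem odd_pow_of_five_le (hp5 : 5 ≤ p) (a : ℕ) : Odd (p ^ a) :=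
  (hp.out.odd_of_ne_two (by omega)).pow

theorem sum_halfBlock_pow_iv_sq_cong (hp5 : 5 ≤ p) {τ : ℤ_[p]} (hτ : 6 * τ = halfCubeSum p) {a : ℕ}
    (ha : a ≠ 0) (c : ℕ) :
    Cong ((p : ℤ_[p]) ^ (a + 1)) (∑ k ∈ halfBlock (p ^ a) c, iv p k ^ 2)
      (-p ^ a * τ * (4 + (-1) ^ c * (3 + 6 * c))) := by
  have h := sum_halfBlock_iv_sq_cong hp5 (odd_pow_of_five_le hp5 a) (dvd_pow_self p ha) c
  refine Cong.cancel (isUnit_six hp5) ?_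
  rw [← hτ] at h
  push_cast at h
  rw [pow_succ']
  exact h.trans (Cong.of_eq (by ring))

theorem sum_mul_halfWeight_cong (hp5 : 5 ≤ p) (r s t a Y : ℕ) (f : ℕ → ℤ_[p]) :
    Cong (p : ℤ_[p]) (∑ x ∈ range (2 * (p ^ a * Y)), f x * halfWeight p r s t (p ^ a * Y) x)
      (∑ c ∈ range (2 * Y), (∑ d ∈ range (p ^ a), f (c * p ^ a + d)) * halfWeight p r s t Y c) := by
  rw [show 2 * (p ^ a * Y) = 2 * Y * p ^ a by ring, sum_range_mul_blocks]
  refine Cong.sum fun c hc => ?_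
  rw [sum_mul]
  refine Cong.sum fun d hd => Cong.const_mul _ ?_
  rw [mem_range] at hc hd
  have hx : c * p ^ a + d < 2 * (p ^ a * Y) := by
    calc c * p ^ a + d < c * p ^ a + p ^ a := by omega
      _ = (c + 1) * p ^ a := by ring
      _ ≤ (2 * Y) * p ^ a := Nat.mul_le_mul_right _ hc
      _ = _ := by ring
  refine (halfWeight_pow_mul_cong_mod hp5 r s t a hx).trans (Cong.of_eq ?_)
  rw [mul_comm c, Nat.mul_add_div (pow_pos hp.out.pos a), Nat.div_eq_of_lt hd, add_zero]

theorem sum_halfWeight_cong (hp5 : 5 ≤ p) (r s t a Y : ℕ) :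
    Cong (p : ℤ_[p]) (∑ x ∈ range (2 * (p ^ a * Y)), halfWeight p r s t (p ^ a * Y) x)
      (p ^ a * ∑ c ∈ range (2 * Y), halfWeight p r s t Y c) := by
  have := sum_mul_halfWeight_cong hp5 r s t a Y (fun _ => 1)
  simpa [mul_sum] using this

theorem sum_alternating_halfWeight_cong (hp5 : 5 ≤ p) (r s t a Y : ℕ) :
    Cong (p : ℤ_[p]) (∑ x ∈ range (2 * (p ^ a * Y)), (-1) ^ x * halfWeight p r s t (p ^ a * Y) x)
      (∑ c ∈ range (2 * Y), (-1) ^ c * halfWeight p r s t Y c) := by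
  refine (sum_mul_halfWeight_cong hp5 r s t a Y (fun x => (-1) ^ x)).trans (Cong.of_eq ?_)
  refine sum_congr rfl fun c _ => ?_
  have hodd := odd_pow_of_five_le hp5 a
  simp_rw [pow_add]
  rw [← mul_sum, neg_one_geom_sum, if_neg (Nat.not_even_iff_odd.mpr hodd), mul_comm c, pow_mul,
    hodd.neg_one_pow, mul_one]

/-- Leading terms of the p weights over one c merge p half-blocks into a larger one;
`sum_harm_mul_weight_cong` evaluates the first-order terms. -/
theorem sum_halfWeight_mul_step (hp5 : 5 ≤ p) {τ : ℤ_[p]} (hτ : 6 * τ = halfCubeSum p) (s t Y : ℕ)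
    {a : ℕ} (ha : a ≠ 0) :
    Cong ((p : ℤ_[p]) * (p ^ (a + 1) * Y))
      (∑ x ∈ range (2 * (p * Y)), halfWeight p 2 s t (p * Y) x *
        ∑ k ∈ halfBlock (p ^ a) x, iv p k ^ 2)
      (∑ c ∈ range (2 * Y), halfWeight p 2 s t Y c * ∑ k ∈ halfBlock (p ^ (a + 1)) c, iv p k ^ 2 -
        p ^ (a + 1) * Y * τ * (s - 2 + 4 * t) * ∑ c ∈ range (2 * Y), halfWeight p 2 s t Y c) := by
  rw [show 2 * (p * Y) = 2 * Y * p by ring, sum_range_mul_blocks, mul_sum, ← sum_sub_distrib]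
  refine Cong.sum fun c hc => ?_
  rw [mem_range] at hc
  set h : ℕ → ℤ_[p] := fun x => (s - 2) * harm p (x / 2) + t * harm p x with hh
  set w : ℕ → ℤ_[p] := fun x => 4 + (-1) ^ x * (3 + 6 * x) with hw
  have h1 : ∀ d ∈ range p, Cong ((p : ℤ_[p]) * (p ^ (a + 1) * Y))
      (halfWeight p 2 s t (p * Y) (c * p + d) * ∑ k ∈ halfBlock (p ^ a) (c * p + d), iv p k ^ 2)
      (halfWeight p 2 s t Y c * (∑ k ∈ halfBlock (p ^ a) (p * c + d), iv p k ^ 2 -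
        p ^ (a + 1) * Y * τ * (h (p * c + d) * w (p * c + d)))) := by
    intro d hd
    rw [mem_range] at hd
    rw [mul_comm c p]
    obtain ⟨x, hx⟩ := halfWeight_mul_cong hp5 2 s t hc hd
    obtain ⟨y, hy⟩ := sum_halfBlock_pow_iv_sq_cong hp5 hτ ha (p * c + d)
    refine ⟨x * (p * y - τ * w (p * c + d)) + halfWeight p 2 s t Y c * h (p * c + d) * y, ?_⟩
    simp only [hh, hw]
    rw [pow_succ] at hy ⊢
    push_cast at hx hy ⊢
    linear_combination (∑ k ∈ halfBlock (p ^ a) (p * c + d), iv p k ^ 2) * hx +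
      (p * (p * Y) * x + halfWeight p 2 s t Y c * p * Y *
        ((s - 2) * harm p ((p * c + d) / 2) + t * harm p (p * c + d))) * hy
  refine (Cong.sum h1).trans ?_
  rw [← mul_sum, sum_sub_distrib, ← mul_sum, pow_succ' p a, sum_halfBlock_mul]
  obtain ⟨z, hz⟩ := sum_harm_mul_weight_cong hp5 (s - 2 : ℤ_[p]) t c
  refine ⟨-halfWeight p 2 s t Y c * τ * z, ?_⟩
  simp only [hh, hw]
  linear_combination (-halfWeight p 2 s t Y c * p ^ (a + 1) * Y * τ) * hz

theorem sum_halfWeight_mul_descent (hp5 : 5 ≤ p) {τ : ℤ_[p]} (hτ : 6 * τ = halfCubeSum p)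
    (s t Y k : ℕ) {a : ℕ} (ha : a ≠ 0) :
    Cong ((p : ℤ_[p]) * (p ^ (a + k) * Y))
      (∑ x ∈ range (2 * (p ^ k * Y)), halfWeight p 2 s t (p ^ k * Y) x *
        ∑ l ∈ halfBlock (p ^ a) x, iv p l ^ 2)
      (∑ c ∈ range (2 * Y), halfWeight p 2 s t Y c * ∑ l ∈ halfBlock (p ^ (a + k)) c, iv p l ^ 2 -
        p ^ (a + k) * Y * τ * (s - 2 + 4 * t) * (∑ i ∈ range k, p ^ i) *
          ∑ c ∈ range (2 * Y), halfWeight p 2 s t Y c) := by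
  induction k generalizing a with
  | zero => simpa using Cong.refl _ _
  | succ k ih =>
    have h1 := sum_halfWeight_mul_step hp5 hτ s t (p ^ k * Y) ha
    have h2 := ih (a := a + 1) (by omega)
    obtain ⟨z, hz⟩ := sum_halfWeight_cong hp5 2 s t k Y
    obtain ⟨x, hx⟩ := h1
    obtain ⟨y, hy⟩ := h2
    rw [show p ^ (k + 1) * Y = p * (p ^ k * Y) by ring, show a + (k + 1) = a + 1 + k by ring]
    refine ⟨x + y - τ * (s - 2 + 4 * t) * z, ?_⟩
    rw [sum_range_succ]
    push_cast at hx hy hz ⊢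
    rw [pow_add _ (a + 1) k] at hy ⊢
    linear_combination hx + hy - p ^ (a + 1) * p ^ k * Y * τ * (s - 2 + 4 * t) * hz

theorem two_mul_sum_iv_sq_mul_halfWeight_cong (hp5 : 5 ≤ p) {τ : ℤ_[p]}
    (hτ : 6 * τ = halfCubeSum p) (s t Y : ℕ) :
    Cong ((p : ℤ_[p]) * (p * Y))
      (2 * ∑ k ∈ range (p * Y), iv p (p * Y - k) ^ 2 * halfWeight p 2 s t (p * Y) (2 * k))
      (2 * (∑ c ∈ range (2 * Y), halfWeight p 2 s t Y c * ∑ k ∈ halfBlock (p ^ 1) c, iv p k ^ 2) +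
        3 * (p * Y) * τ * (-(s - 2 + 4 * t) * (∑ c ∈ range (2 * Y), halfWeight p 2 s t Y c) +
          (4 + 2 * s + t) * ∑ c ∈ range (2 * Y), (-1) ^ c * halfWeight p 2 s t Y c)) := by
  rw [mul_comm p Y, sum_range_eq_sum_halfBlock, mul_comm Y p, pow_one]
  simp only [mul_sum, ← sum_add_distrib]
  refine Cong.sum fun c hc => ?_
  rw [mem_range] at hc
  simp only [← mul_sum]
  have h1 : ∀ k ∈ halfBlock p c, Cong ((p : ℤ_[p]) * (p * Y))
      (iv p (p * Y - k) ^ 2 * halfWeight p 2 s t (p * Y) (2 * k))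
      (halfWeight p 2 s t Y c * (iv p k ^ 2 + p * Y * (2 * iv p k ^ 3 + iv p k ^ 2 *
        ((s - 2) * harm p k + t * harm p (2 * k))))) := by
    intro k hk
    rw [mem_halfBlock] at hk
    obtain ⟨d, hd⟩ := Nat.exists_eq_add_of_le hk.1
    have hdp : d < p := by rw [add_mul] at hk; omega
    rw [mul_comm c p] at hd
    have hkY : k ≤ p * Y := by
      have : (c + 1) * p ≤ 2 * (p * Y) := by
        calc (c + 1) * p ≤ (2 * Y) * p := Nat.mul_le_mul_right _ hc
          _ = _ := by ring
      omega
    have e1 := halfWeight_mul_cong hp5 2 s t hc hdp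
    rw [← hd, Nat.mul_div_cancel_left k two_pos] at e1
    obtain ⟨x, hx⟩ := e1
    obtain ⟨y, hy⟩ := iv_sq_sub_cong (dvd_mul_right p Y) hkY
    refine ⟨iv p (p * Y - k) ^ 2 * x + halfWeight p 2 s t Y c *
      (1 + p * Y * ((s - 2) * harm p k + t * harm p (2 * k))) * Y * y +
      halfWeight p 2 s t Y c * 2 * Y * iv p k ^ 3 * ((s - 2) * harm p k + t * harm p (2 * k)), ?_⟩
    push_cast at hx hy ⊢
    linear_combination iv p (p * Y - k) ^ 2 * hx + halfWeight p 2 s t Y c *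
      (1 + p * Y * ((s - 2) * harm p k + t * harm p (2 * k))) * hy
  obtain ⟨x, hx⟩ := Cong.sum h1
  have h2 : Cong (p : ℤ_[p]) (2 * ∑ k ∈ halfBlock p c,
        (2 * iv p k ^ 3 + iv p k ^ 2 * ((s - 2) * harm p k + t * harm p (2 * k))))
      (3 * τ * (-(s - 2 + 4 * t) + (-1) ^ c * (4 + 2 * s + t))) := by
    refine Cong.cancel (isUnit_two hp5) ?_
    refine (Cong.of_eq (by ring)).trans
      ((sum_halfBlock_harm_cong hp5 (s - 2 : ℤ_[p]) t c).trans (Cong.of_eq ?_))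
    rw [← hτ]
    ring
  rw [← mul_sum, sum_add_distrib, ← mul_sum] at hx
  obtain ⟨y, hy⟩ := h2
  refine ⟨2 * x + halfWeight p 2 s t Y c * y, ?_⟩
  linear_combination 2 * hx + halfWeight p 2 s t Y c * p * Y * hy

/-- The correction in p^m - 1 comes from the geometric sum of the descent. Mod p it is 0 for m = 0
and -1 otherwise; this form treats both at once and matches the contribution of the multiples of p.
-/
theorem two_mul_sum_iv_sq_mul_halfWeight_pow_cong (hp5 : 5 ≤ p) {τ : ℤ_[p]}
    (hτ : 6 * τ = halfCubeSum p) (s t n m : ℕ) :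
    Cong ((p : ℤ_[p]) ^ (m + 2))
      (2 * ∑ k ∈ range (p ^ (m + 1) * n), iv p (p ^ (m + 1) * n - k) ^ 2 *
        halfWeight p 2 s t (p ^ (m + 1) * n) (2 * k))
      (p ^ (m + 1) * τ * ∑ c ∈ range (2 * n), halfWeight p 2 s t n c *
        (-2 * (4 + (-1) ^ c * (3 + 6 * c)) + 3 * n * (4 + 2 * s + t) * (-1) ^ c -
          3 * n * (s - 2 + 4 * t) - n * (s - 2 + 4 * t) * (p ^ m - 1))) := by
  have h0 := two_mul_sum_iv_sq_mul_halfWeight_cong hp5 hτ s t (p ^ m * n)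
  rw [show p * (p ^ m * n) = p ^ (m + 1) * n by ring] at h0
  have h1 := sum_halfWeight_mul_descent hp5 hτ s t n m one_ne_zero
  obtain ⟨a, ha⟩ := sum_halfWeight_cong hp5 2 s t m n
  obtain ⟨b, hb⟩ := sum_alternating_halfWeight_cong hp5 2 s t m n
  have h2 : Cong ((p : ℤ_[p]) ^ (m + 2))
      (∑ c ∈ range (2 * n), halfWeight p 2 s t n c * ∑ l ∈ halfBlock (p ^ (1 + m)) c, iv p l ^ 2)
      (∑ c ∈ range (2 * n), halfWeight p 2 s t n c *
        (-p ^ (m + 1) * τ * (4 + (-1) ^ c * (3 + 6 * c)))) := by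
    refine Cong.sum fun c _ => Cong.const_mul _ ?_
    rw [add_comm 1 m]
    exact sum_halfBlock_pow_iv_sq_cong hp5 hτ (Nat.succ_ne_zero m) c
  obtain ⟨x, hx⟩ := h0
  obtain ⟨y, hy⟩ := h1
  obtain ⟨z, hz⟩ := h2
  have hgeom := geom_sum_mul (p : ℤ_[p]) m
  have hsplit : ∑ c ∈ range (2 * n), halfWeight p 2 s t n c *
        (-2 * (4 + (-1) ^ c * (3 + 6 * c)) + 3 * n * (4 + 2 * s + t) * (-1) ^ c -
          3 * n * (s - 2 + 4 * t) - n * (s - 2 + 4 * t) * ((p : ℤ_[p]) ^ m - 1)) =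
      -2 * ∑ c ∈ range (2 * n), halfWeight p 2 s t n c * (4 + (-1) ^ c * (3 + 6 * c)) +
      3 * n * (4 + 2 * s + t) * ∑ c ∈ range (2 * n), (-1) ^ c * halfWeight p 2 s t n c -
      (3 * n * (s - 2 + 4 * t) + n * (s - 2 + 4 * t) * ((p : ℤ_[p]) ^ m - 1)) *
        ∑ c ∈ range (2 * n), halfWeight p 2 s t n c := by
    simp only [mul_sum, ← sum_add_distrib, ← sum_sub_distrib]
    exact sum_congr rfl fun c _ => by ring
  have hz' : ∑ c ∈ range (2 * n), halfWeight p 2 s t n c *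
      (-(p : ℤ_[p]) ^ (m + 1) * τ * (4 + (-1) ^ c * (3 + 6 * c))) = -(p : ℤ_[p]) ^ (m + 1) * τ *
      ∑ c ∈ range (2 * n), halfWeight p 2 s t n c * (4 + (-1) ^ c * (3 + 6 * c)) := by
    rw [mul_sum]
    exact sum_congr rfl fun c _ => by ring
  rw [hz'] at hz
  rw [hsplit]
  set u : ℤ_[p] := s - 2 + 4 * t
  set SU := ∑ c ∈ range (2 * n), halfWeight p 2 s t n c
  set SV := ∑ c ∈ range (2 * n), (-1) ^ c * halfWeight p 2 s t n c
  set SW := ∑ c ∈ range (2 * n), halfWeight p 2 s t n c * (4 + (-1) ^ c * (3 + 6 * c))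
  refine ⟨n * x + 2 * n * y + 2 * z + 3 * n * τ * (-u * a + (4 + 2 * s + t) * b) -
    2 * n * τ * u * SU * ∑ i ∈ range m, (p : ℤ_[p]) ^ i, ?_⟩
  push_cast at hx hy ⊢
  rw [add_comm 1 m] at hy hz
  linear_combination hx + 2 * hy + 2 * hz + 3 * (p ^ (m + 1) * n) * τ * (-u * ha +
    (4 + 2 * s + t) * hb) + 2 * p ^ (m + 1) * n * τ * u * SU * hgeom

theorem four_mul_sum_iv_cube_mul_halfWeight_pow_cong (hp5 : 5 ≤ p) {τ : ℤ_[p]}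
    (hτ : 6 * τ = halfCubeSum p) (s t n : ℕ) {m : ℕ} (hm : m ≠ 0) :
    Cong (p : ℤ_[p])
      (4 * ∑ k ∈ range (p ^ m * n), iv p (p ^ m * n - k) ^ 3 * ((-1) ^ k *
        halfWeight p 3 s t (p ^ m * n) (2 * k)))
      (-3 * τ * ∑ c ∈ range (2 * n), (-1) ^ (c / 2) * halfWeight p 3 s t n c) := by
  have hpN : p ∣ p ^ m * n := (dvd_pow_self p hm).mul_right n
  have h1 : Cong (p : ℤ_[p]) (∑ k ∈ range (p ^ m * n), iv p (p ^ m * n - k) ^ 3 * ((-1) ^ k *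
        halfWeight p 3 s t (p ^ m * n) (2 * k)))
      (∑ c ∈ range (2 * n), ∑ k ∈ halfBlock (p ^ m) c,
        -(halfWeight p 3 s t n c * ((-1) ^ k * iv p k ^ 3))) := by
    rw [mul_comm (p ^ m) n, sum_range_eq_sum_halfBlock, mul_comm n]
    refine Cong.sum fun c hc => Cong.sum fun k hk => ?_
    rw [mem_range] at hc
    rw [mem_halfBlock] at hk
    have hk2 : 2 * k < 2 * (p ^ m * n) := by
      calc 2 * k < (c + 1) * p ^ m := hk.2
        _ ≤ (2 * n) * p ^ m := Nat.mul_le_mul_right _ hc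
        _ = _ := by ring
    have e1 := halfWeight_pow_mul_cong_mod hp5 3 s t m hk2
    rw [Nat.div_eq_of_lt_le hk.1 hk.2] at e1
    have e2 := ((iv_sub_cong hpN (x := k) (by omega)).of_dvd (natCast_dvd_of_dvd hpN)).pow 3
    exact (e2.mul (e1.const_mul _)).trans (Cong.of_eq (by ring))
  refine Cong.cancel (isUnit_two hp5) ?_
  refine ((h1.const_mul 4).const_mul 2).trans ?_
  simp only [mul_sum, mul_neg, sum_neg_distrib]
  rw [← sum_neg_distrib]
  refine Cong.sum fun c _ => ?_
  obtain ⟨z, hz⟩ := sum_halfBlock_alternating_iv_cube_cong hp5 (odd_pow_of_five_le hp5 m)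
    (dvd_pow_self p hm) c
  refine ⟨-halfWeight p 3 s t n c * z, ?_⟩
  simp only [← mul_sum]
  linear_combination -halfWeight p 3 s t n c * hz + (-1) ^ (c / 2) * halfWeight p 3 s t n c * hτ

end Descent

/-- The `k`-th summand of `aperyA r s t n`. -/
def aperyTerm (r s t n k : ℕ) : ℕ :=
  n.choose k ^ r * (n + k).choose k ^ s * (2 * k).choose n ^ t

/-! ### Summands at multiples of p -/

section MultiplesOfP

variable {p : ℕ} [hp : Fact p.Prime]

theorem exists_mul_choose_eq (hp5 : 5 ≤ p) {τ : ℤ_[p]} (hτ : 6 * τ = halfCubeSum p)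
    {q Q M j : ℕ} (hq : ∃ e, q = p ^ e) (hqj : q ∣ j) (hqQ : q ∣ Q) (hQM : Q ∣ M) (hj : j ≤ M) :
    ∃ φ : ℤ_[p], ((p * M).choose (p * j) : ℤ_[p]) = M.choose j * φ ∧
      Cong ((p : ℤ_[p]) ^ 4 * Q * q ^ 2) φ (1 + p ^ 3 * τ * (M * j * (M - j))) := by
  -- For j = M the factor M - j cancelled below is zero.
  rcases hj.eq_or_lt with rfl | hlt
  · exact ⟨1, by simp, Cong.of_eq (by ring)⟩
  refine ⟨∏ i ∈ range (p * j), (1 + p * -(M : ℤ_[p]) * iv p i), ?_, ?_⟩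
  · have hodd : Odd p := hp.out.odd_of_ne_two (by omega)
    have hltp : p * j < p * M := Nat.mul_lt_mul_of_pos_left hlt hp.out.pos
    have h1 := pred_choose_eq_prod (p := p) hltp
    rw [prod_range_succ, iv_of_dvd (dvd_mul_right p j), mul_zero, sub_zero, mul_one,
      Nat.mul_div_cancel_left _ hp.out.pos, pow_mul, hodd.neg_one_pow] at h1
    have h2 := pred_choose_mul (R := ℤ_[p]) hlt
    have h3 := pred_choose_mul (R := ℤ_[p]) hltp
    have hne : ((p : ℤ_[p]) * (M - j)) ≠ 0 := by
      refine mul_ne_zero (by exact_mod_cast hp.out.ne_zero) (sub_ne_zero.mpr ?_)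
      exact_mod_cast hlt.ne'
    apply mul_right_cancel₀ hne
    have h4 : ((p * M - 1).choose (p * j) : ℤ_[p]) =
        (M - 1).choose j * ∏ i ∈ range (p * j), (1 + p * -(M : ℤ_[p]) * iv p i) := by
      have hsq : ((-1 : ℤ_[p]) ^ j) * (-1) ^ j = 1 := by rw [← mul_pow]; simp
      have h5 : ∏ i ∈ range (p * j), (1 - (p : ℤ_[p]) * M * iv p i) =
          ∏ i ∈ range (p * j), (1 + p * -(M : ℤ_[p]) * iv p i) :=
        prod_congr rfl fun i _ => by ring
      rw [h5] at h1
      linear_combination (-1) ^ j * h1 + (-((p * M - 1).choose (p * j) : ℤ_[p]) +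
        (M - 1).choose j * ∏ i ∈ range (p * j), (1 + p * -(M : ℤ_[p]) * iv p i)) * hsq
    push_cast at h3
    linear_combination h3 + p * M * h4 -
      p * (∏ i ∈ range (p * j), (1 + p * -(M : ℤ_[p]) * iv p i)) * h2
  · exact (prod_one_add_mul_iv_cong hp5 hτ hq hqj hqQ
      (dvd_neg.mpr (natCast_dvd_of_dvd hQM))).trans (Cong.of_eq (by ring))

theorem exists_add_mul_choose_eq (hp5 : 5 ≤ p) {τ : ℤ_[p]} (hτ : 6 * τ = halfCubeSum p)
    {q Q M j : ℕ} (hq : ∃ e, q = p ^ e) (hqj : q ∣ j) (hqQ : q ∣ Q) (hQM : Q ∣ M) :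
    ∃ φ : ℤ_[p], ((p * M + p * j).choose (p * j) : ℤ_[p]) = (M + j).choose j * φ ∧
      Cong ((p : ℤ_[p]) ^ 4 * Q * q ^ 2) φ (1 + p ^ 3 * τ * (M * j * (M + j))) := by
  refine ⟨∏ i ∈ range (p * j), (1 + p * (M : ℤ_[p]) * iv p i), ?_, ?_⟩
  · rw [add_choose_eq_prod, prod_range_succ, iv_of_dvd (dvd_mul_right p j), mul_zero, add_zero,
      mul_one, Nat.mul_div_cancel_left _ hp.out.pos]
  · exact prod_one_add_mul_iv_cong hp5 hτ hq hqj hqQ (natCast_dvd_of_dvd hQM)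

theorem exists_two_mul_choose_eq (hp5 : 5 ≤ p) {τ : ℤ_[p]} (hτ : 6 * τ = halfCubeSum p)
    {q Q M j : ℕ} (hq : ∃ e, q = p ^ e) (hqj : q ∣ j) (hqQ : q ∣ Q) (hQM : Q ∣ M) :
    ∃ φ : ℤ_[p], ((2 * (p * j)).choose (p * M) : ℤ_[p]) = (2 * j).choose M * φ ∧
      Cong ((p : ℤ_[p]) ^ 4 * Q * q ^ 2) φ (1 + p ^ 3 * τ * (M * (2 * j - M) * (2 * j))) := by
  rcases lt_or_ge (2 * j) M with h | h
  · refine ⟨_, ?_, Cong.refl _ _⟩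
    have h1 : 2 * (p * j) < p * M := by
      rw [mul_left_comm]
      exact Nat.mul_lt_mul_of_pos_left h hp.out.pos
    rw [Nat.choose_eq_zero_of_lt h, Nat.choose_eq_zero_of_lt h1]
    simp
  · obtain ⟨z, hz⟩ := Nat.exists_eq_add_of_le h
    have hqz : q ∣ z := by
      have : q ∣ M + z := hz ▸ hqj.mul_left 2
      exact (Nat.dvd_add_right (hqQ.trans hQM)).mp this
    obtain ⟨φ, h1, h2⟩ := exists_add_mul_choose_eq hp5 hτ hq hqz hqQ hQM
    refine ⟨φ, ?_, h2.trans (Cong.of_eq ?_)⟩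
    · rw [mul_left_comm 2 p j, hz, mul_add p M z, Nat.choose_symm_add, h1, Nat.choose_symm_add]
    · have : (2 * j : ℤ_[p]) = M + z := by exact_mod_cast congrArg (Nat.cast (R := ℤ_[p])) hz
      rw [this]
      ring

/-- Each ratio is known modulo p⁴Qq²; as r ≥ 2, the summand contains C(M,j)², and Q² ∣ C(M,j)²q²
raises this to p⁴Q³. -/
theorem aperyTerm_mul_cong (hp5 : 5 ≤ p) {τ : ℤ_[p]} (hτ : 6 * τ = halfCubeSum p) {r : ℕ}
    (hr : 2 ≤ r) (s t : ℕ) {q Q M j : ℕ} (hq : ∃ e, q = p ^ e) (hqj : q ∣ j) (hqQ : q ∣ Q)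
    (hQM : Q ∣ M) (hj : j ≤ M) (hQ : Q ∣ M.choose j * q) :
    Cong ((p : ℤ_[p]) ^ 4 * Q ^ 3) (aperyTerm r s t (p * M) (p * j) : ℤ_[p])
      (aperyTerm r s t M j * (1 + p ^ 3 * τ *
        (M * j * ((r + s - 2 * t) * M + (s - r + 4 * t) * j)))) := by
  obtain ⟨φ₁, e₁, h₁⟩ := exists_mul_choose_eq hp5 hτ hq hqj hqQ hQM hj
  obtain ⟨φ₂, e₂, h₂⟩ := exists_add_mul_choose_eq hp5 hτ hq hqj hqQ hQM
  obtain ⟨φ₃, e₃, h₃⟩ := exists_two_mul_choose_eq hp5 hτ hq hqj hqQ hQM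
  set D : ℤ_[p] := (p : ℤ_[p]) ^ 4 * Q * q ^ 2 with hD
  have hterm : (aperyTerm r s t (p * M) (p * j) : ℤ_[p]) =
      aperyTerm r s t M j * (φ₁ ^ r * φ₂ ^ s * φ₃ ^ t) := by
    rw [aperyTerm, aperyTerm]
    push_cast
    rw [e₁, e₂, e₃]
    ring
  obtain ⟨j', hj'⟩ := natCast_dvd_of_dvd (p := p) hqj
  obtain ⟨M', hM'⟩ := natCast_dvd_of_dvd (p := p) hQM
  obtain ⟨Q', hQ'⟩ := natCast_dvd_of_dvd (p := p) hqQ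
  have hz : ∀ y : ℤ_[p], p ^ 3 * τ * (M * (q * y)) = p ^ 3 * τ * Q * q * (M' * y) := by
    intro y
    rw [hM']
    ring
  have hprod : ∀ y y' : ℤ_[p], D ∣ (p ^ 3 * τ * Q * q * y) * (p ^ 3 * τ * Q * q * y') := by
    intro y y'
    refine ⟨p ^ 2 * τ ^ 2 * Q * y * y', ?_⟩
    rw [hD]
    ring
  have hM'' : (M : ℤ_[p]) = q * (Q' * M') := by rw [hM', hQ']; ring
  have z₁ : (p : ℤ_[p]) ^ 3 * τ * (M * j * (M - j)) =
      p ^ 3 * τ * Q * q * (M' * (j' * (M - j))) := by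
    rw [← hz, hj']; ring
  have z₂ : (p : ℤ_[p]) ^ 3 * τ * (M * j * (M + j)) =
      p ^ 3 * τ * Q * q * (M' * (j' * (M + j))) := by
    rw [← hz, hj']; ring
  have z₃ : (p : ℤ_[p]) ^ 3 * τ * (M * (2 * j - M) * (2 * j)) =
      p ^ 3 * τ * Q * q * (M' * (2 * j' * (2 * j - M))) := by
    rw [← hz, hj']; ring
  rw [z₁] at h₁
  rw [z₂] at h₂
  rw [z₃] at h₃
  have f₁ := (h₁.pow r).trans (Cong.one_add_pow (hprod _ _) r)
  have f₂ := (h₂.pow s).trans (Cong.one_add_pow (hprod _ _) s)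
  have f₃ := (h₃.pow t).trans (Cong.one_add_pow (hprod _ _) t)
  have f : Cong D (φ₁ ^ r * φ₂ ^ s * φ₃ ^ t) (1 + p ^ 3 * τ *
        (M * j * ((r + s - 2 * t) * M + (s - r + 4 * t) * j))) := by
    refine ((f₁.mul f₂).mul f₃).trans ?_
    set y₁ := M' * (j' * ((M : ℤ_[p]) - j)) with hy₁
    set y₂ := M' * (j' * ((M : ℤ_[p]) + j)) with hy₂
    set y₃ := M' * (2 * j' * (2 * (j : ℤ_[p]) - M)) with hy₃
    refine ⟨p ^ 2 * τ ^ 2 * Q * (r * s * y₁ * y₂ + r * t * y₁ * y₃ + s * t * y₂ * y₃ +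
      r * s * t * y₁ * y₂ * y₃ * p ^ 3 * τ * Q * q), ?_⟩
    rw [hD]
    linear_combination (-r * z₁ - s * z₂ - t * z₃)
  rw [hterm]
  refine (f.scale (aperyTerm r s t M j : ℤ_[p])).of_dvd ?_
  obtain ⟨c, hc⟩ := natCast_dvd_of_dvd (p := p) hQ
  obtain ⟨r', rfl⟩ := Nat.exists_eq_add_of_le hr
  refine ⟨c ^ 2 * (M.choose j : ℤ_[p]) ^ r' * ((M + j).choose j : ℤ_[p]) ^ s *
    ((2 * j).choose M : ℤ_[p]) ^ t, ?_⟩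
  rw [hD, aperyTerm]
  push_cast at hc ⊢
  rw [pow_add]
  linear_combination ((p : ℤ_[p]) ^ 4 * Q * (M.choose j : ℤ_[p]) ^ r' *
    ((M + j).choose j : ℤ_[p]) ^ s * ((2 * j).choose M : ℤ_[p]) ^ t *
    (M.choose j * q + Q * c)) * hc

theorem dvd_choose_mul_gcd {Q M j : ℕ} (hQM : Q ∣ M) : Q ∣ M.choose j * Nat.gcd j Q := by
  have h1 : Q ∣ M.choose j * j := by
    rcases j with _ | j
    · simp
    rcases M with _ | M
    · simp
    · rw [← Nat.add_one_mul_choose_eq]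
      exact hQM.mul_right _
  have h2 := Nat.dvd_gcd h1 (dvd_mul_left Q (M.choose j))
  rwa [Nat.gcd_mul_left] at h2

end MultiplesOfP

theorem sum_range_mul_succ_split {R : Type*} [AddCommMonoid R] (F : ℕ → R) {Q : ℕ} (hQ : 0 < Q)
    (n : ℕ) : ∑ k ∈ range (Q * n + 1), F k =
      ∑ J ∈ range (n + 1), F (Q * J) + ∑ k ∈ range (Q * n), if Q ∣ k then 0 else F k := by
  have h1 : ∑ k ∈ range (Q * n), F k = ∑ k ∈ range (Q * n), (if Q ∣ k then F k else 0) +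
      ∑ k ∈ range (Q * n), if Q ∣ k then 0 else F k := by
    rw [← sum_add_distrib]
    exact sum_congr rfl fun k _ => by split_ifs <;> simp
  have h2 : ∑ k ∈ range (Q * n), (if Q ∣ k then F k else 0) = ∑ J ∈ range n, F (Q * J) := by
    rw [mul_comm, sum_range_mul_blocks]
    refine sum_congr rfl fun J _ => ?_
    rw [sum_eq_single 0]
    · rw [add_zero, if_pos (dvd_mul_left Q J), mul_comm]
    · intro l hl hl0
      rw [mem_range] at hl
      rw [if_neg]
      rw [Nat.dvd_add_right (dvd_mul_left Q J)]
      exact Nat.not_dvd_of_pos_of_lt (Nat.pos_of_ne_zero hl0) hl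
    · intro h
      exact absurd (mem_range.mpr hQ) h
  rw [sum_range_succ, h1, h2, sum_range_succ _ n]
  exact add_right_comm _ _ _

/-! ### Reduction of the main sum from p^a n to n -/

section SecondOrder

variable {p : ℕ} [hp : Fact p.Prime]

theorem exists_sixth_halfCubeSum (hp5 : 5 ≤ p) : ∃ τ : ℤ_[p], 6 * τ = halfCubeSum p := by
  obtain ⟨u, hu⟩ := isUnit_six (p := p) hp5
  exact ⟨(u⁻¹ : ℤ_[p]ˣ) * halfCubeSum p, by rw [← hu, Units.mul_inv_cancel_left]⟩

theorem aperyTerm_pow_mul_cong_mod (hp5 : 5 ≤ p) {r : ℕ} (hr : 2 ≤ r) (s t a : ℕ) {n J : ℕ}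
    (hJ : J ≤ n) :
    Cong (p : ℤ_[p]) (aperyTerm r s t (p ^ a * n) (p ^ a * J) : ℤ_[p]) (aperyTerm r s t n J) := by
  obtain ⟨τ, hτ⟩ := exists_sixth_halfCubeSum (p := p) hp5
  induction a with
  | zero => simpa using Cong.refl _ _
  | succ a ih =>
    have h := aperyTerm_mul_cong hp5 hτ hr s t (q := 1) (Q := 1) (M := p ^ a * n) (j := p ^ a * J)
      ⟨0, by simp⟩ (one_dvd _) (one_dvd _) (one_dvd _) (Nat.mul_le_mul_left _ hJ) (one_dvd _)
    rw [pow_succ', mul_assoc, mul_assoc]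
    refine Cong.trans ?_ ih
    obtain ⟨z, hz⟩ := h
    refine ⟨p ^ 3 * z + aperyTerm r s t (p ^ a * n) (p ^ a * J) * (p ^ 2 * τ *
      (((p ^ a * n : ℕ) : ℤ_[p]) * (p ^ a * J : ℕ) * ((r + s - 2 * t) * (p ^ a * n : ℕ) +
        (s - r + 4 * t) * (p ^ a * J : ℕ)))), ?_⟩
    push_cast at hz ⊢
    linear_combination hz

/-- The factor by which the `k`-th summand of `aperyA r s t n` is weighted in `scriptAMain`. -/
def mainFactor (R : Type*) [CommRing R] (r s t n k : ℕ) : R :=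
  n * k * ((r + s - 2 * t) * n + (s - r + 4 * t) * k)

theorem aperyTerm_mul_mainFactor_of_dvd (hp5 : 5 ≤ p) {r : ℕ} (hr : 2 ≤ r) (s t a : ℕ) {n J : ℕ}
    (hJ : J ≤ n) :
    Cong ((p : ℤ_[p]) * (p ^ a) ^ 3)
      (aperyTerm r s t (p ^ a * n) (p ^ a * J) * mainFactor ℤ_[p] r s t (p ^ a * n) (p ^ a * J))
      ((p ^ a) ^ 3 * (aperyTerm r s t n J * mainFactor ℤ_[p] r s t n J)) := by
  obtain ⟨z, hz⟩ := aperyTerm_pow_mul_cong_mod hp5 hr s t a hJ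
  refine ⟨z * mainFactor ℤ_[p] r s t n J, ?_⟩
  simp only [mainFactor]
  push_cast
  linear_combination (p ^ a : ℤ_[p]) ^ 3 * n * J * ((r + s - 2 * t) * n + (s - r + 4 * t) * J) * hz

theorem p_dvd_choose_of_not_dvd {a M j : ℕ} (hM : p ^ a ∣ M) (hj : ¬ p ^ a ∣ j) :
    p ∣ M.choose j := by
  obtain ⟨e, he, hg⟩ := (Nat.dvd_prime_pow hp.out).mp (Nat.gcd_dvd_right j (p ^ a))
  have hlt : e < a := by
    refine lt_of_le_of_ne he fun h => hj ?_
    rw [← h, ← hg]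
    exact Nat.gcd_dvd_left _ _
  have h1 := dvd_choose_mul_gcd (j := j) hM
  rw [hg] at h1
  have h2 : p ^ e * p ∣ p ^ e * M.choose j := by
    rw [← pow_succ, mul_comm]
    exact (pow_dvd_pow p hlt).trans h1
  exact Nat.dvd_of_mul_dvd_mul_left (pow_pos hp.out.pos e) h2

theorem dvd_choose_mul_self {Q M j : ℕ} (hQM : Q ∣ M) : Q ∣ M.choose j * j :=
  (dvd_choose_mul_gcd hQM).trans (Nat.mul_dvd_mul_left _ (Nat.gcd_dvd_left _ _))

/-- Three factors C = C(M,j) make CM, Cj and a combination of them, each divisible by p^a; CM has an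
extra p from C. -/
theorem aperyTerm_mul_mainFactor_of_not_dvd {r : ℕ} (hr : 3 ≤ r) (s t a : ℕ) {M j : ℕ}
    (hM : p ^ a ∣ M) (hj : ¬ p ^ a ∣ j) :
    Cong ((p : ℤ_[p]) * (p ^ a) ^ 3) (aperyTerm r s t M j * mainFactor ℤ_[p] r s t M j) 0 := by
  obtain ⟨c, hc⟩ := natCast_dvd_of_dvd (p := p) (p_dvd_choose_of_not_dvd hM hj)
  obtain ⟨M', hM'⟩ := natCast_dvd_of_dvd (p := p) hM
  obtain ⟨x, hx⟩ := natCast_dvd_of_dvd (p := p) (dvd_choose_mul_self (j := j) hM)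
  obtain ⟨r', rfl⟩ := Nat.exists_eq_add_of_le hr
  refine Cong.zero_of_dvd ⟨c * x * M' * ((M.choose j : ℤ_[p]) *
    (((3 + r' : ℕ) : ℤ_[p]) + s - 2 * t) * M' + (s - ((3 + r' : ℕ) : ℤ_[p]) + 4 * t) * x) *
    (M.choose j : ℤ_[p]) ^ r' * ((M + j).choose j : ℤ_[p]) ^ s *
    ((2 * j).choose M : ℤ_[p]) ^ t, ?_⟩
  have key : (M.choose j : ℤ_[p]) ^ 3 * (M * j * ((((3 + r' : ℕ) : ℤ_[p]) + s - 2 * t) * M +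
      (s - ((3 + r' : ℕ) : ℤ_[p]) + 4 * t) * j)) = (p : ℤ_[p]) * (p ^ a) ^ 3 * (c * x * M' *
      ((M.choose j : ℤ_[p]) * (((3 + r' : ℕ) : ℤ_[p]) + s - 2 * t) * M' +
        (s - ((3 + r' : ℕ) : ℤ_[p]) + 4 * t) * x)) := by
    set A := (((3 + r' : ℕ) : ℤ_[p]) + s - 2 * t)
    set B := (s - ((3 + r' : ℕ) : ℤ_[p]) + 4 * t)
    set C := (M.choose j : ℤ_[p])
    push_cast at hM' hx
    have e : C ^ 3 * (M * j * (A * M + B * j)) = C * M * (C * j) * (A * (C * M) + B * (C * j)) := by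
      ring
    rw [e, hx, hM']
    linear_combination (p ^ a * M' * (p ^ a * x) * (A * (C * (p ^ a * M')) + B * (p ^ a * x))) * hc
  rw [aperyTerm, mainFactor]
  push_cast at key ⊢
  rw [pow_add]
  linear_combination ((M.choose j : ℤ_[p]) ^ r' * ((M + j).choose j : ℤ_[p]) ^ s *
    ((2 * j).choose M : ℤ_[p]) ^ t) * key

/-- With only C² available, the j² part survives: C(M-j) = M·C(M-1,j) turns it into M³ times a
weight, and all other terms contain M²C times CM or Cj. -/
theorem aperyTerm_two_mul_mainFactor_of_not_dvd (hp5 : 5 ≤ p) (s t a : ℕ) {n j : ℕ}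
    (hj : ¬ p ^ a ∣ j) (hjn : j < p ^ a * n) :
    Cong ((p : ℤ_[p]) * (p ^ a) ^ 3)
      (aperyTerm 2 s t (p ^ a * n) j * mainFactor ℤ_[p] 2 s t (p ^ a * n) j)
      ((p ^ a) ^ 3 * (n ^ 3 * (s - 2 + 4 * t) * halfWeight p 2 s t n (2 * j / p ^ a))) := by
  have hM : p ^ a ∣ p ^ a * n := dvd_mul_right _ _
  obtain ⟨c, hc⟩ := natCast_dvd_of_dvd (p := p) (p_dvd_choose_of_not_dvd hM hj)
  obtain ⟨x, hx⟩ := natCast_dvd_of_dvd (p := p) (dvd_choose_mul_self (j := j) hM)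
  obtain ⟨z, hz⟩ := halfWeight_pow_mul_cong_mod hp5 2 s t a (Y := n) (x := 2 * j) (by omega)
  have h1 := pred_choose_mul (R := ℤ_[p]) hjn
  rw [halfWeight, Nat.mul_div_cancel_left j two_pos] at hz
  have hs : ((-1 : ℤ_[p]) ^ j) ^ 2 = 1 := by rw [← pow_mul, mul_comm, pow_mul]; simp
  rw [mul_pow ((-1 : ℤ_[p]) ^ j), hs, one_mul] at hz
  rw [aperyTerm, mainFactor]
  set U := halfWeight p 2 s t n (2 * j / p ^ a)
  push_cast at h1 hx hz ⊢
  set C := ((p ^ a * n).choose j : ℤ_[p])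
  set V := ((p ^ a * n - 1).choose j : ℤ_[p])
  set E := ((p ^ a * n + j).choose j : ℤ_[p]) ^ s
  set G := ((2 * j).choose (p ^ a * n) : ℤ_[p]) ^ t
  set M : ℤ_[p] := p ^ a * n with hM'
  set u : ℤ_[p] := s - 2 + 4 * t with hu
  have key : C ^ 2 * (M * j * ((2 + s - 2 * t) * M + u * j)) = M ^ 3 * u * V ^ 2 +
      M ^ 2 * C * ((2 + s - 2 * t) * (C * j) - u * (C * M) + 2 * u * (C * j)) := by
    linear_combination (M * u * (C * (M - j) + M * V)) * h1
  refine ⟨n ^ 3 * u * z + n ^ 2 * c * ((2 + s - 2 * t) * x - u * (C * n) + 2 * u * x) * E * G, ?_⟩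
  have hM3 : (p ^ a : ℤ_[p]) ^ 3 * n ^ 3 = M ^ 3 := by rw [hM']; ring
  have e2 : M ^ 2 * C * ((2 + s - 2 * t) * (C * j) - u * (C * M) + 2 * u * (C * j)) =
      p * (p ^ a) ^ 3 * (n ^ 2 * c * ((2 + s - 2 * t) * x - u * (C * n) + 2 * u * x)) := by
    rw [hx]
    have : C * M = p ^ a * (C * n) := by rw [hM']; ring
    rw [this, hM']
    linear_combination ((p ^ a * n) ^ 2 * ((2 + s - 2 * t) * (p ^ a * x) - u * (p ^ a * (C * n)) +
      2 * u * (p ^ a * x))) * hc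
  linear_combination E * G * key + E * G * e2 + (p ^ a) ^ 3 * n ^ 3 * u * hz - u * V ^ 2 * E * G * hM3

theorem two_mul_sum_not_dvd_halfBlock {L : ℕ} (hodd : Odd L) (c : ℕ) :
    2 * ∑ k ∈ halfBlock L c, (if L ∣ k then 0 else 1 : ℤ_[p]) = L - 1 := by
  obtain ⟨g, hg⟩ := hodd
  have hmain : ∀ f : ℕ → ℤ_[p], f 0 = 0 → (∀ l < g, f (l + 1) = 1) →
      2 * ∑ l ∈ range (g + 1), f l = L - 1 := by
    intro f h0 h1
    rw [sum_range_succ', h0, sum_congr rfl fun l hl => h1 l (mem_range.mp hl), hg]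
    simp
  rcases Nat.even_or_odd' c with ⟨K, rfl | rfl⟩
  · rw [sum_halfBlock_even _ hg]
    refine hmain _ (if_pos (by simp)) fun l hl => if_neg ?_
    rw [Nat.dvd_add_right (dvd_mul_left L K)]
    exact Nat.not_dvd_of_pos_of_lt (by omega) (by omega)
  · rw [sum_halfBlock_odd (fun k => if L ∣ k then 0 else 1) hg _ (if_pos (dvd_mul_left _ _))]
    refine hmain _ (if_pos (by simp)) fun l hl => if_neg ?_
    rw [Nat.dvd_sub_iff_right (by rw [add_mul]; omega) (dvd_mul_left _ _)]
    exact Nat.not_dvd_of_pos_of_lt (by omega) (by omega)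

/-- Each half-block of length parameter p^a contains exactly (p^a - 1)/2 non-multiples of p^a. -/
theorem two_mul_sum_not_dvd_halfWeight (hp5 : 5 ≤ p) (f : ℕ → ℤ_[p]) (a n : ℕ) :
    2 * ∑ j ∈ range (p ^ a * n), (if p ^ a ∣ j then 0 else f (2 * j / p ^ a)) =
      (p ^ a - 1) * ∑ c ∈ range (2 * n), f c := by
  rw [mul_comm (p ^ a) n, sum_range_eq_sum_halfBlock, mul_sum, mul_sum]
  refine sum_congr rfl fun c _ => ?_
  have h := two_mul_sum_not_dvd_halfBlock (p := p) (odd_pow_of_five_le hp5 a) c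
  push_cast at h
  rw [← h, mul_assoc, sum_mul]
  congr 1
  refine sum_congr rfl fun k hk => ?_
  rw [mem_halfBlock] at hk
  rw [Nat.div_eq_of_lt_le hk.1 hk.2]
  split_ifs <;> simp

theorem sum_aperyTerm_mul_cong (hp5 : 5 ≤ p) {τ : ℤ_[p]} (hτ : 6 * τ = halfCubeSum p) {r : ℕ}
    (hr : 2 ≤ r) (s t a n : ℕ) :
    Cong ((p : ℤ_[p]) ^ (3 * a + 4))
      (∑ j ∈ range (p ^ a * n + 1), (aperyTerm r s t (p ^ (a + 1) * n) (p * j) : ℤ_[p]))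
      (∑ j ∈ range (p ^ a * n + 1), (aperyTerm r s t (p ^ a * n) j : ℤ_[p]) + p ^ 3 * τ *
        ∑ j ∈ range (p ^ a * n + 1),
          (aperyTerm r s t (p ^ a * n) j * mainFactor ℤ_[p] r s t (p ^ a * n) j)) := by
  rw [mul_sum, ← sum_add_distrib]
  refine Cong.sum fun j hj => ?_
  rw [mem_range] at hj
  have h := aperyTerm_mul_cong hp5 hτ hr s t (q := Nat.gcd j (p ^ a)) (Q := p ^ a)
    (M := p ^ a * n) (j := j)
    (by
      obtain ⟨e, -, he⟩ := (Nat.dvd_prime_pow hp.out).mp (Nat.gcd_dvd_right j (p ^ a))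
      exact ⟨e, he⟩)
    (Nat.gcd_dvd_left _ _) (Nat.gcd_dvd_right _ _) (dvd_mul_right _ _) (by omega)
    (dvd_choose_mul_gcd (dvd_mul_right _ _))
  rw [show p * (p ^ a * n) = p ^ (a + 1) * n by ring] at h
  refine (h.of_dvd ⟨1, by push_cast; ring⟩).trans (Cong.of_eq ?_)
  rw [mainFactor]
  ring

theorem sum_aperyTerm_mul_mainFactor_cong (hp5 : 5 ≤ p) {r : ℕ} (hr : 3 ≤ r) (s t a n : ℕ) :
    Cong ((p : ℤ_[p]) * (p ^ a) ^ 3)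
      (∑ j ∈ range (p ^ a * n + 1),
          (aperyTerm r s t (p ^ a * n) j * mainFactor ℤ_[p] r s t (p ^ a * n) j))
      ((p ^ a) ^ 3 * ∑ J ∈ range (n + 1), (aperyTerm r s t n J * mainFactor ℤ_[p] r s t n J)) := by
  rw [sum_range_mul_succ_split _ (pow_pos hp.out.pos a), mul_sum]
  have h1 := Cong.sum (s := range (n + 1)) fun J hJ =>
    aperyTerm_mul_mainFactor_of_dvd hp5 (by omega : 2 ≤ r) s t a (n := n) (J := J)
      (by rw [mem_range] at hJ; omega)
  have h2 : Cong ((p : ℤ_[p]) * (p ^ a) ^ 3)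
      (∑ j ∈ range (p ^ a * n), if p ^ a ∣ j then 0 else
        (aperyTerm r s t (p ^ a * n) j * mainFactor ℤ_[p] r s t (p ^ a * n) j))
      (∑ j ∈ range (p ^ a * n), 0) := by
    refine Cong.sum fun j hj => ?_
    split_ifs with h
    · exact Cong.refl _ _
    · exact aperyTerm_mul_mainFactor_of_not_dvd hr s t a (dvd_mul_right _ _) h
  exact (h1.add h2).trans (Cong.of_eq (by rw [sum_const_zero, add_zero]))

theorem two_mul_sum_aperyTerm_two_mul_mainFactor_cong (hp5 : 5 ≤ p) (s t a n : ℕ) :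
    Cong ((p : ℤ_[p]) * (p ^ a) ^ 3)
      (2 * ∑ j ∈ range (p ^ a * n + 1),
          (aperyTerm 2 s t (p ^ a * n) j * mainFactor ℤ_[p] 2 s t (p ^ a * n) j))
      ((p ^ a) ^ 3 * (2 * ∑ J ∈ range (n + 1),
        (aperyTerm 2 s t n J * mainFactor ℤ_[p] 2 s t n J) +
        n ^ 3 * (s - 2 + 4 * t) * ((p ^ a - 1) * ∑ c ∈ range (2 * n), halfWeight p 2 s t n c))) := by
  rw [sum_range_mul_succ_split _ (pow_pos hp.out.pos a)]
  have h1 := Cong.sum (s := range (n + 1)) fun J hJ =>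
    aperyTerm_mul_mainFactor_of_dvd hp5 (le_refl 2) s t a (n := n) (J := J)
      (by rw [mem_range] at hJ; omega)
  have h2 : Cong ((p : ℤ_[p]) * (p ^ a) ^ 3)
      (∑ j ∈ range (p ^ a * n), if p ^ a ∣ j then 0 else
        (aperyTerm 2 s t (p ^ a * n) j * mainFactor ℤ_[p] 2 s t (p ^ a * n) j))
      (∑ j ∈ range (p ^ a * n), if p ^ a ∣ j then 0 else
        ((p ^ a) ^ 3 * (n ^ 3 * (s - 2 + 4 * t) * halfWeight p 2 s t n (2 * j / p ^ a)))) := by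
    refine Cong.sum fun j hj => ?_
    split_ifs with h
    · exact Cong.refl _ _
    · exact aperyTerm_two_mul_mainFactor_of_not_dvd hp5 s t a h (mem_range.mp hj)
  refine ((h1.add h2).const_mul 2).trans (Cong.of_eq ?_)
  rw [mul_add, two_mul_sum_not_dvd_halfWeight hp5 (fun c => (p ^ a : ℤ_[p]) ^ 3 *
    (n ^ 3 * (s - 2 + 4 * t) * halfWeight p 2 s t n c)), ← mul_sum, ← mul_sum, ← mul_sum]
  ring

end SecondOrder

/-! ### Assembling the congruence -/

section Assembly

variable {p : ℕ} [hp : Fact p.Prime]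

theorem aperyA_eq_sum_aperyTerm (r s t n : ℕ) :
    aperyA r s t n = ∑ k ∈ range (n + 1), aperyTerm r s t n k := rfl

theorem aperyTerm_eq_of_lt {r : ℕ} (hr : r ≠ 0) (s t : ℕ) {N k : ℕ} (hpN : p ∣ N) (hk : k < N) :
    (if p ∣ k then 0 else (aperyTerm r s t N k : ℤ_[p])) =
      N ^ r * (iv p (N - k) ^ r * ((-1) ^ (k * r) * halfWeight p r s t N (2 * k))) := by
  split_ifs with h
  · rw [iv_of_dvd (Nat.dvd_sub hpN h), zero_pow hr]
    ring
  · have h1 := mul_iv (p := p) (k := N - k) fun h' => h ((Nat.dvd_sub_iff_right hk.le hpN).mp h')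
    have h2 := pred_choose_mul (R := ℤ_[p]) hk
    rw [Nat.cast_sub hk.le] at h1
    have h3 : (N.choose k : ℤ_[p]) = N * iv p (N - k) * (N - 1).choose k := by
      linear_combination iv p (N - k) * h2 - (N.choose k : ℤ_[p]) * h1
    have hs : (-1 : ℤ_[p]) ^ (k * r) * (-1) ^ (k * r) = 1 := by rw [← mul_pow]; simp
    rw [aperyTerm, halfWeight, Nat.mul_div_cancel_left k two_pos]
    push_cast
    rw [h3, mul_pow ((-1 : ℤ_[p]) ^ k), ← pow_mul]
    linear_combination (-(N ^ r * iv p (N - k) ^ r * ((N - 1).choose k : ℤ_[p]) ^ r *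
      ((N + k).choose k : ℤ_[p]) ^ s * ((2 * k).choose N : ℤ_[p]) ^ t)) * hs

theorem aperyA_pow_mul_eq {r : ℕ} (hr : r ≠ 0) (s t a n : ℕ) :
    (aperyA r s t (p ^ (a + 1) * n) : ℤ_[p]) =
      ∑ j ∈ range (p ^ a * n + 1), (aperyTerm r s t (p ^ (a + 1) * n) (p * j) : ℤ_[p]) +
      (p ^ (a + 1) * n) ^ r * ∑ k ∈ range (p ^ (a + 1) * n), iv p (p ^ (a + 1) * n - k) ^ r *
        ((-1) ^ (k * r) * halfWeight p r s t (p ^ (a + 1) * n) (2 * k)) := by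
  rw [aperyA_eq_sum_aperyTerm, Nat.cast_sum]
  have hN : p ^ (a + 1) * n = p * (p ^ a * n) := by ring
  have h1 := sum_range_mul_succ_split (fun k => (aperyTerm r s t (p ^ (a + 1) * n) k : ℤ_[p]))
    hp.out.pos (p ^ a * n)
  rw [← hN] at h1
  rw [h1, mul_sum]
  congr 1
  refine sum_congr rfl fun k hk => ?_
  rw [aperyTerm_eq_of_lt hr s t (hN ▸ dvd_mul_right _ _) (mem_range.mp hk)]
  push_cast
  ring

/-- The sum in `scriptAMain` without the factor `-1 / 3`, over an arbitrary ring. -/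
def mainSum (R : Type*) [CommRing R] (r s t n : ℕ) : R :=
  ∑ k ∈ range (n + 1), (aperyTerm r s t n k : R) * mainFactor R r s t n k

theorem sum_aperyTerm_cong (hp5 : 5 ≤ p) {τ : ℤ_[p]} (hτ : 6 * τ = halfCubeSum p) {r : ℕ}
    (hr : 3 ≤ r) (s t a n : ℕ) :
    Cong ((p : ℤ_[p]) ^ (3 * a + 4))
      (∑ j ∈ range (p ^ a * n + 1), (aperyTerm r s t (p ^ (a + 1) * n) (p * j) : ℤ_[p]))
      (aperyA r s t (p ^ a * n) + p ^ (3 * a + 3) * τ * mainSum ℤ_[p] r s t n) := by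
  have h1 := sum_aperyTerm_mul_cong hp5 hτ (by omega : 2 ≤ r) s t a n
  have h2 := (sum_aperyTerm_mul_mainFactor_cong hp5 hr s t a n).scale (p ^ 3 * τ : ℤ_[p])
  have h3 := h2.of_dvd (e := (p : ℤ_[p]) ^ (3 * a + 4)) ⟨τ, by ring⟩
  refine h1.trans (((Cong.refl _ _).add h3).trans (Cong.of_eq ?_))
  rw [aperyA_eq_sum_aperyTerm, Nat.cast_sum, mainSum]
  ring

theorem aperyA_cong_of_four_le (hp5 : 5 ≤ p) {τ : ℤ_[p]} (hτ : 6 * τ = halfCubeSum p) {r : ℕ}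
    (hr : 4 ≤ r) (s t a n : ℕ) :
    Cong ((p : ℤ_[p]) ^ (3 * a + 4)) (aperyA r s t (p ^ (a + 1) * n) : ℤ_[p])
      (aperyA r s t (p ^ a * n) + p ^ (3 * a + 3) * τ * mainSum ℤ_[p] r s t n) := by
  rw [aperyA_pow_mul_eq (by omega)]
  refine ((sum_aperyTerm_cong hp5 hτ (by omega) s t a n).add (Cong.zero_of_dvd ?_)).trans
    (Cong.of_eq (add_zero _))
  refine Dvd.dvd.mul_right ?_ _
  rw [mul_pow, ← pow_mul]
  refine Dvd.dvd.mul_right (pow_dvd_pow _ ?_) _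
  calc 3 * a + 4 ≤ (a + 1) * 4 := by omega
    _ ≤ (a + 1) * r := Nat.mul_le_mul_left _ hr

theorem aperyA_three_cong (hp5 : 5 ≤ p) {τ : ℤ_[p]} (hτ : 6 * τ = halfCubeSum p) (s t a n : ℕ) :
    Cong ((p : ℤ_[p]) ^ (3 * a + 4)) (4 * (aperyA 3 s t (p ^ (a + 1) * n) : ℤ_[p]))
      (4 * aperyA 3 s t (p ^ a * n) + p ^ (3 * a + 3) * (4 * τ * mainSum ℤ_[p] 3 s t n -
        3 * τ * (n ^ 3 * ∑ c ∈ range (2 * n), (-1) ^ (c / 2) * halfWeight p 3 s t n c))) := by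
  rw [aperyA_pow_mul_eq (by omega)]
  have h1 := (sum_aperyTerm_cong hp5 hτ (le_refl 3) s t a n).const_mul 4
  have h2 := (four_mul_sum_iv_cube_mul_halfWeight_pow_cong hp5 hτ s t n (m := a + 1)
    (Nat.succ_ne_zero a)).scale ((p ^ (a + 1) * n) ^ 3 : ℤ_[p])
  have h3 := h2.of_dvd (e := (p : ℤ_[p]) ^ (3 * a + 4)) ⟨n ^ 3, by ring⟩
  have hs : ∀ k, (-1 : ℤ_[p]) ^ (k * 3) = (-1) ^ k := fun k => by
    rw [mul_comm, pow_mul]; norm_num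
  simp only [hs]
  exact (Cong.of_eq (by ring)).trans ((h1.add h3).trans (Cong.of_eq (by ring)))

/-- The multiples of p^a - 1 from the indices divisible by p and from the others cancel, which
removes the dependence on a. -/
theorem aperyA_two_cong (hp5 : 5 ≤ p) {τ : ℤ_[p]} (hτ : 6 * τ = halfCubeSum p) (s t a n : ℕ) :
    Cong ((p : ℤ_[p]) ^ (3 * a + 4)) (2 * (aperyA 2 s t (p ^ (a + 1) * n) : ℤ_[p]))
      (2 * aperyA 2 s t (p ^ a * n) + p ^ (3 * a + 3) * τ * (2 * mainSum ℤ_[p] 2 s t n +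
        n ^ 2 * ∑ c ∈ range (2 * n), halfWeight p 2 s t n c *
          (-2 * (4 + (-1) ^ c * (3 + 6 * c)) + 3 * n * (4 + 2 * s + t) * (-1) ^ c -
            3 * n * (s - 2 + 4 * t)))) := by
  rw [aperyA_pow_mul_eq (by omega)]
  have h1 := (sum_aperyTerm_mul_cong hp5 hτ (le_refl 2) s t a n).const_mul 2
  have h2 := (two_mul_sum_aperyTerm_two_mul_mainFactor_cong hp5 s t a n).scale (p ^ 3 * τ : ℤ_[p])
  have h3 := h2.of_dvd (e := (p : ℤ_[p]) ^ (3 * a + 4)) ⟨τ, by ring⟩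
  have h4 := (two_mul_sum_iv_sq_mul_halfWeight_pow_cong hp5 hτ s t n a).scale
    ((p ^ (a + 1) * n) ^ 2 : ℤ_[p])
  have h5 := h4.of_dvd (e := (p : ℤ_[p]) ^ (3 * a + 4)) ⟨n ^ 2, by ring⟩
  have hs : ∀ k, (-1 : ℤ_[p]) ^ (k * 2) = 1 := fun k => by
    rw [mul_comm, pow_mul]; norm_num
  simp only [hs, one_mul]
  have hsplit : ∑ c ∈ range (2 * n), halfWeight p 2 s t n c *
        (-2 * (4 + (-1) ^ c * (3 + 6 * c)) + 3 * n * (4 + 2 * s + t) * (-1) ^ c -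
          3 * n * (s - 2 + 4 * t) - n * (s - 2 + 4 * t) * ((p : ℤ_[p]) ^ a - 1)) =
      ∑ c ∈ range (2 * n), halfWeight p 2 s t n c *
        (-2 * (4 + (-1) ^ c * (3 + 6 * c)) + 3 * n * (4 + 2 * s + t) * (-1) ^ c -
          3 * n * (s - 2 + 4 * t)) -
      n * (s - 2 + 4 * t) * ((p : ℤ_[p]) ^ a - 1) * ∑ c ∈ range (2 * n), halfWeight p 2 s t n c := by
    rw [mul_sum, ← sum_sub_distrib]
    exact sum_congr rfl fun c _ => by ring
  rw [hsplit] at h5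
  rw [aperyA_eq_sum_aperyTerm, Nat.cast_sum, mainSum]
  obtain ⟨x, hx⟩ := h1
  obtain ⟨y, hy⟩ := h3
  obtain ⟨z, hz⟩ := h5
  exact ⟨x + y + z, by linear_combination hx + hy + hz⟩

theorem sum_range_two_mul {R : Type*} [AddCommMonoid R] (f : ℕ → R) (n : ℕ) :
    ∑ c ∈ range (2 * n), f c = ∑ k ∈ range n, (f (2 * k) + f (2 * k + 1)) := by
  rw [mul_comm, sum_range_mul_blocks]
  refine sum_congr rfl fun k _ => ?_
  rw [sum_range_succ, sum_range_one, add_zero, mul_comm]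

/-- Six times `scriptAExtraTwo`, over an arbitrary ring. -/
def extraTwo (R : Type*) [CommRing R] (s t n : ℕ) : R :=
  ∑ k ∈ range n,
      (n.choose k : R) ^ 2 * ((n + k).choose k : R) ^ s * ((2 * k).choose n : R) ^ t *
        (((n : R) - k) ^ 2 * (9 * n * t - 3 * n * s + 24 * k - 18 * n + 14)) +
  ∑ k ∈ range n,
      (n.choose k : R) ^ 2 * ((n + k).choose k : R) ^ s * ((2 * k + 1).choose n : R) ^ t *
        (((n : R) - k) ^ 2 * (9 * n * s + 15 * n * t - 24 * k + 6 * n - 10))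

/-- Four times `scriptAExtraThree`, over an arbitrary ring. -/
def extraThree (R : Type*) [CommRing R] (s t n : ℕ) : R :=
  ∑ k ∈ range n,
    ((n : R) - k) ^ 3 * (n.choose k : R) ^ 3 * ((n + k).choose k : R) ^ s *
      (((2 * k).choose n : R) ^ t + ((2 * k + 1).choose n : R) ^ t)

theorem extraTwo_eq (s t n : ℕ) :
    n ^ 2 * ∑ c ∈ range (2 * n), halfWeight p 2 s t n c *
      (-2 * (4 + (-1) ^ c * (3 + 6 * c)) + 3 * n * (4 + 2 * s + t) * (-1) ^ c -
        3 * n * (s - 2 + 4 * t)) = -extraTwo ℤ_[p] s t n := by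
  rw [sum_range_two_mul, extraTwo, mul_sum, ← sum_add_distrib, ← sum_neg_distrib]
  refine sum_congr rfl fun k hk => ?_
  have h := pred_choose_mul (R := ℤ_[p]) (mem_range.mp hk)
  have hs : ((-1 : ℤ_[p]) ^ k) ^ 2 = 1 := by rw [← pow_mul, mul_comm, pow_mul]; simp
  rw [halfWeight, halfWeight, Nat.mul_div_cancel_left k two_pos,
    show (2 * k + 1) / 2 = k by omega, Even.neg_one_pow ⟨k, two_mul k⟩, Odd.neg_one_pow ⟨k, rfl⟩,
    mul_pow ((-1 : ℤ_[p]) ^ k), hs]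
  set C := (n.choose k : ℤ_[p])
  set V := ((n - 1).choose k : ℤ_[p])
  have h2 : C ^ 2 * (n - k) ^ 2 = n ^ 2 * V ^ 2 := by
    rw [← mul_pow, h, mul_pow]
  push_cast
  linear_combination (((n + k).choose k : ℤ_[p]) ^ s) * (((2 * k).choose n : ℤ_[p]) ^ t *
    (9 * n * t - 3 * n * s + 24 * k - 18 * n + 14) + ((2 * k + 1).choose n : ℤ_[p]) ^ t *
    (9 * n * s + 15 * n * t - 24 * k + 6 * n - 10)) * h2

theorem extraThree_eq (s t n : ℕ) :
    n ^ 3 * ∑ c ∈ range (2 * n), (-1) ^ (c / 2) * halfWeight p 3 s t n c =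
      extraThree ℤ_[p] s t n := by
  rw [sum_range_two_mul, extraThree, mul_sum]
  refine sum_congr rfl fun k hk => ?_
  have h := pred_choose_mul (R := ℤ_[p]) (mem_range.mp hk)
  have hs : ((-1 : ℤ_[p]) ^ k) ^ 4 = 1 := by rw [← pow_mul, mul_comm, pow_mul]; norm_num
  rw [halfWeight, halfWeight, Nat.mul_div_cancel_left k two_pos,
    show (2 * k + 1) / 2 = k by omega]
  set C := (n.choose k : ℤ_[p])
  set V := ((n - 1).choose k : ℤ_[p])
  have h3 : C ^ 3 * (n - k) ^ 3 = n ^ 3 * V ^ 3 := by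
    rw [← mul_pow, h, mul_pow]
  linear_combination (((n + k).choose k : ℤ_[p]) ^ s) * (((2 * k).choose n : ℤ_[p]) ^ t +
    ((2 * k + 1).choose n : ℤ_[p]) ^ t) * (n ^ 3 * V ^ 3 * hs - h3)

/-- Twelve times `scriptA`, as an element of an arbitrary ring. -/
def scriptATwelve (R : Type*) [CommRing R] (r s t n : ℕ) : R :=
  -4 * mainSum R r s t n +
    if r = 2 then 2 * extraTwo R s t n else if r = 3 then 3 * extraThree R s t n else 0

theorem scriptATwelve_rat (r s t n : ℕ) : scriptATwelve ℚ r s t n = 12 * scriptA r s t n := by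
  have hmain : mainSum ℚ r s t n = -3 * scriptAMain r s t n := by
    rw [mainSum, scriptAMain, ← mul_assoc]
    norm_num
    refine sum_congr rfl fun k _ => ?_
    rw [aperyTerm, mainFactor]
    push_cast
    ring
  rw [scriptATwelve, scriptA]
  split_ifs with h2 h3
  · subst h2
    rw [hmain, scriptAExtraTwo, extraTwo]
    ring
  · subst h3
    rw [hmain, scriptAExtraThree, extraThree]
    ring
  · rw [hmain]
    ring

theorem map_scriptATwelve {R S : Type*} [CommRing R] [CommRing S] (f : R →+* S) (r s t n : ℕ) :
    f (scriptATwelve R r s t n) = scriptATwelve S r s t n := by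
  simp only [scriptATwelve, mainSum, mainFactor, extraTwo, extraThree]
  split_ifs <;> simp [map_ofNat]

/-- The factor 12 clears the denominators of `scriptA`, so one expression makes sense in ℤ_[p], ℚ
and ℚ_[p]. -/
theorem twelve_mul_aperyA_cong (hp5 : 5 ≤ p) {β : ℤ_[p]}
    (hβ : (β : ℚ_[p]) = ((bernoulli (p - 3) : ℚ) : ℚ_[p])) {r : ℕ} (hr : 2 ≤ r) (s t a n : ℕ) :
    Cong ((p : ℤ_[p]) ^ (3 * a + 4)) (12 * (aperyA r s t (p ^ (a + 1) * n) : ℤ_[p]))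
      (12 * aperyA r s t (p ^ a * n) +
        p ^ (3 * a + 3) * β * scriptATwelve ℤ_[p] r s t n) := by
  obtain ⟨τ, hτ⟩ := exists_sixth_halfCubeSum (p := p) hp5
  have hτβ : Cong (p : ℤ_[p]) (-3 * τ) β := by
    have h := halfCubeSum_cong_bernoulli hp5 hβ
    rw [← hτ] at h
    refine Cong.cancel (isUnit_two hp5) ?_
    exact (Cong.of_eq (by ring)).trans (h.neg.trans (Cong.of_eq (by ring)))
  have hscale := ((hτβ.mul_const (scriptATwelve ℤ_[p] r s t n)).scale
    ((p : ℤ_[p]) ^ (3 * a + 3))).of_dvd (e := (p : ℤ_[p]) ^ (3 * a + 4)) ⟨1, by ring⟩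
  have key : Cong ((p : ℤ_[p]) ^ (3 * a + 4)) (12 * (aperyA r s t (p ^ (a + 1) * n) : ℤ_[p]))
      (12 * aperyA r s t (p ^ a * n) +
        p ^ (3 * a + 3) * (-3 * τ * scriptATwelve ℤ_[p] r s t n)) := by
    rw [scriptATwelve]
    split_ifs with h2 h3
    · subst h2
      have h := (aperyA_two_cong hp5 hτ s t a n).const_mul 6
      rw [extraTwo_eq] at h
      exact (Cong.of_eq (by ring)).trans (h.trans (Cong.of_eq (by ring)))
    · subst h3
      have h := (aperyA_three_cong hp5 hτ s t a n).const_mul 3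
      rw [extraThree_eq] at h
      exact (Cong.of_eq (by ring)).trans (h.trans (Cong.of_eq (by ring)))
    · have h := (aperyA_cong_of_four_le hp5 hτ (by omega : 4 ≤ r) s t a n).const_mul 12
      exact h.trans (Cong.of_eq (by ring))
  exact key.trans (((Cong.refl _ _).add hscale).trans (Cong.of_eq (by ring)))

/-- Since k is a p-adic unit, (x-y)/p^e has norm at most 1, so its denominator is prime to p. -/
theorem ratCongr_of_mul_sub_eq {e k : ℕ} {x y : ℚ} (hk : ¬ p ∣ k) (w : ℤ_[p])
    (h : (k : ℚ_[p]) * ((x : ℚ_[p]) - y) = p ^ e * (w : ℚ_[p])) : RatCongr p e x y := by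
  have hp0 : (p : ℚ) ≠ 0 := by exact_mod_cast hp.out.ne_zero
  have hp0' : (p : ℚ_[p]) ≠ 0 := by exact_mod_cast hp.out.ne_zero
  refine ⟨(x - y) / p ^ e, ?_, by field_simp⟩
  rw [← isUnit_natCast_iff]
  refine PadicInt.isUnit_den _ ?_
  have hkn : ‖(k : ℚ_[p])‖ = 1 := by
    have := PadicInt.isUnit_iff.mp (isUnit_natCast_iff.mpr hk)
    rwa [PadicInt.norm_def, PadicInt.coe_natCast] at this
  have hw : (k : ℚ_[p]) * (((x - y) / p ^ e : ℚ) : ℚ_[p]) = w := by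
    push_cast
    rw [mul_div_assoc', h, mul_div_cancel_left₀ _ (pow_ne_zero _ hp0')]
  calc ‖(((x - y) / p ^ e : ℚ) : ℚ_[p])‖ = ‖(w : ℚ_[p])‖ := by rw [← hw, norm_mul, hkn, one_mul]
    _ ≤ 1 := w.2

end Assembly

theorem theorem1p1 (p : ℕ) (hp : p.Prime) (hp5 : 5 ≤ p) (n m : ℕ) (hn : 1 ≤ n) (hm : 1 ≤ m)
    (r s t : ℕ) (hr : 2 ≤ r) :
    RatCongr p (3 * m + 1)
      (aperyA r s t (n * p ^ m) : ℚ)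
      ((aperyA r s t (n * p ^ (m - 1)) : ℚ)
        + (p : ℚ) ^ (3 * m) * bernoulli (p - 3) * scriptA r s t n) := by
  have : Fact p.Prime := ⟨hp⟩
  obtain ⟨a, rfl⟩ : ∃ a, m = a + 1 := ⟨m - 1, by omega⟩
  obtain ⟨β, hβ⟩ := exists_padicInt_eq_bernoulli (p := p) (n := p - 3) (by omega)
  obtain ⟨w, hw⟩ := twelve_mul_aperyA_cong hp5 hβ hr s t a n
  have h12 : ¬ p ∣ 12 := by
    intro h
    have h' : p ∣ 2 * 2 * 3 := h
    rcases hp.dvd_mul.mp h' with h | h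
    · rcases hp.dvd_mul.mp h with h | h <;> have := Nat.le_of_dvd two_pos h <;> omega
    · have := Nat.le_of_dvd three_pos h
      omega
  refine ratCongr_of_mul_sub_eq h12 w ?_
  have hw' := congrArg (PadicInt.Coe.ringHom (p := p)) hw
  simp only [map_sub, map_mul, map_add, map_pow, map_natCast, map_ofNat, map_scriptATwelve] at hw'
  have hA : scriptATwelve ℚ_[p] r s t n = 12 * ((scriptA r s t n : ℚ) : ℚ_[p]) := by
    have := congrArg (Rat.castHom ℚ_[p]) (scriptATwelve_rat r s t n)
    rw [map_scriptATwelve] at this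
    simpa using this
  have hβ' : PadicInt.Coe.ringHom β = ((bernoulli (p - 3) : ℚ) : ℚ_[p]) := hβ
  rw [hA, hβ'] at hw'
  have hw'' : PadicInt.Coe.ringHom w = (w : ℚ_[p]) := rfl
  rw [hw''] at hw'
  rw [show a + 1 - 1 = a by omega, mul_comm n, mul_comm n,
    show 3 * (a + 1) + 1 = 3 * a + 4 by ring, show 3 * (a + 1) = 3 * a + 3 by ring, ← hw']
  push_cast
  ring
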